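/- Let $i,j\ge 1$ and $k\ge 0$ be integers. Let $W$ be the Coxeter group of the tree consisting of three paths $r_0,r_1,\dots,r_k$; $r_0,t_1,\dots,t_i$; $r_0,s_1,\dots,s_j$ with common end $r_0$ (order $3$ for adjacent generators, order $2$ for other pairs of distinct generators). The vertices of the $k_{i,j}$-figure are the cosets $V=W/W'$, where $W'$ is generated by all the generators except $r_k$; let $v=W'$. (The figure is a polytope if $W$ is finite and a tessellation if $W$ is affine; these are the cases $ijk\le i+j+k+2$.) Take variables $y_0,\dots,y_k$ and $y_{mn}$ ($0\le m\le i$, $0\le n\le j$). The generators act on them by $$t_m: y_{(m-1)n}\leftrightarrow y_{mn};\qquad s_n: y_{m(n-1)}\leftrightarrow y_{mn};\qquad r_n: y_{n-1}\leftrightarrow y_n\ (n\ge1);\qquad r_0: y_0\leftrightarrow y_{00},\ y_{mn}\mapsto\bar y_{mn}\ (m,n\ge 1),$$ all other variables being fixed, where $\bar y_{mn}$ is determined by $$\frac{(y_0-y_{m0})(y_{0n}-y_{mn})(y_{00}-\bar y_{mn})}{(y_0-y_{mn})(y_{00}-y_{m0})(y_{0n}-\bar y_{mn})}=1 .$$ Associate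 with the variables the vertices $d(y_n)=r_{n+1}\cdots r_k v$ and $d(y_{mn})=t_m\cdots t_1\,s_n\cdots s_1\,r_0r_1\cdots r_k v$. The octahedral cells are the images under $W$ of the octahedron with opposite pairs of vertices $$\{d(y_0),\,r_0d(y_{11})\},\quad \{d(y_{01}),\,d(y_{10})\},\quad \{d(y_{00}),\,d(y_{11})\}.$$ (For $k=0$ they are the octahedral faces; in general they are the octahedra spanned by three axes of a cross-polytope $k_{1,1}$.) In the inversive plane $\mathbb C\cup\{\infty\}$ circles are the Euclidean circles and the lines completed by $\infty$. Six points $x_{ab}$ ($1\le a<b\le4$), with opposite pairs $\{x_{12},x_{34}\}$, $\{x_{13},x_{24}\}$, $\{x_{14},x_{23}\}$, are points of a $C_4$ circle pattern if there are two further points $P,Q$ and eight circles $c_a,d_a$ ($1\le a\le 4$), with the eight points distinct and the eight circles distinct, such that $c_a$ passes through $P$ and the three points $x_{bc}$ with $a\notin\{b,c\}$, and $d_a$ passes through $Q$ and the three points $x_{ab}$ with $b\ne a$. Then: 1. The actions of the generators extend to an action $\rho$ of $W$ by $\mathbb C$-automorphisms of the field of rational functions in the variables. 2. If complex values are given to the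 variables in general position (that is, outside the zero sets of countably many, and finitely many if $W$ is finite, nonzero polynomials in the values and their complex conjugates), then there is a unique map $x:V\to\mathbb C\cup\{\infty\}$ such that $x(d(y_p))$ is the given value of $y_p$ for every variable $y_p$, and the vertices of every octahedral cell are sent to points of a $C_4$ circle pattern. This map is injective: it is a combinatorial $k_{i,j}$-figure in the inversive plane. 3. For every $w\in W$ and every variable $y_p$, the rational function $\rho(w)y_p$ is regular at the given values, and its value there is $x(w\,d(y_p))$. So the birational actions give the images of the determining set under the combinatorial symmetries $w\in W$ of the figure. -/

import Mathlib

open scoped OnePoint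

namespace GossetElte

/-- Generators: `r n` (`0 ≤ n ≤ k`), `t m` and `s n`. The element `m : Fin i` stands for
`t_{m+1}`, and `n : Fin j` for `s_{n+1}`. -/
abbrev Node (k i j : ℕ) : Type := Fin (k + 1) ⊕ (Fin i ⊕ Fin j)

/-- Positions of the two arrays: `inl n` is the entry `y_n` of the first array, and `inr (m, n)`
is the entry `y_{mn}` (column `m`, row `n`) of the second. -/
abbrev Pos (k i j : ℕ) : Type := Fin (k + 1) ⊕ (Fin (i + 1) × Fin (j + 1))

/-! ### The Coxeter group and the figure -/

/-- Edges of the Coxeter graph (each in one direction): three paths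
`r_0 - r_1 - ⋯ - r_k`, `r_0 - t_1 - ⋯ - t_i`, `r_0 - s_1 - ⋯ - s_j`
with the common end `r_0`. -/
def Link {k i j : ℕ} : Node k i j → Node k i j → Prop
  | .inl a, .inl b => a.val + 1 = b.val
  | .inl a, .inr (.inl m) => a.val = 0 ∧ m.val = 0
  | .inl a, .inr (.inr n) => a.val = 0 ∧ n.val = 0
  | .inr (.inl m), .inr (.inl m') => m.val + 1 = m'.val
  | .inr (.inr n), .inr (.inr n') => n.val + 1 = n'.val
  | _, _ => False

open Classical in
/-- The Coxeter matrix of the graph: `3` on edges, `2` on other pairs of distinct nodes. -/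
noncomputable def coxeterMatrix (k i j : ℕ) : CoxeterMatrix (Node k i j) where
  M := Matrix.of fun a b => if a = b then 1 else if Link a b ∨ Link b a then 3 else 2
  isSymm := by
    ext a b
    simp only [Matrix.transpose_apply, Matrix.of_apply, eq_comm (a := b), or_comm]
  diagonal := by
    intro a
    simp
  off_diagonal := by
    intro a b h
    simp only [Matrix.of_apply, h, if_false]
    split_ifs <;> norm_num

/-- The Coxeter group of the graph. -/
abbrev W (k i j : ℕ) : Type := (coxeterMatrix k i j).Group

/-- The generator of the Coxeter group at a node. -/
noncomputable def gen {k i j : ℕ} (a : Node k i j) : W k i j := (coxeterMatrix k i j).simple a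

/-- The stabiliser of the base vertex, generated by all generators but `r_k`. -/
noncomputable def vertexStabilizer (k i j : ℕ) : Subgroup (W k i j) :=
  Subgroup.closure {g | ∃ a : Node k i j, a ≠ .inl (Fin.last k) ∧ g = gen a}

/-- The vertices of the `k_{i,j}`-figure (the ringed node of the graph is `r_k`), as cosets.
The Coxeter group acts on them by left multiplication. -/
abbrev Vertex (k i j : ℕ) : Type := W k i j ⧸ vertexStabilizer k i j

/-- The base vertex of the figure. -/
noncomputable def baseVertex (k i j : ℕ) : Vertex k i j := ((1 : W k i j) : Vertex k i j)

/-- The product `r_{n} r_{n+1} ⋯ r_k`. -/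
noncomputable def rProd (k i j n : ℕ) : W k i j :=
  ((List.ofFn fun a : Fin (k + 1) => (gen (.inl a) : W k i j)).drop n).prod

/-- The product `t_m t_{m-1} ⋯ t_1`. -/
noncomputable def tProd (k i j m : ℕ) : W k i j :=
  ((List.ofFn fun a : Fin i => (gen (.inr (.inl a)) : W k i j)).take m).reverse.prod

/-- The product `s_n s_{n-1} ⋯ s_1`. -/
noncomputable def sProd (k i j n : ℕ) : W k i j :=
  ((List.ofFn fun a : Fin j => (gen (.inr (.inr a)) : W k i j)).take n).reverse.prod

/-- The vertices of the determining sub-figure. The vertex of `y_k` is the base vertex, that of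
`y_n` is `r_{n+1} ⋯ r_k` applied to it, and that of `y_{mn}` is
`t_m ⋯ t_1 s_n ⋯ s_1 r_0 r_1 ⋯ r_k` applied to it. -/
noncomputable def detVertex {k i j : ℕ} : Pos k i j → Vertex k i j
  | .inl n => rProd k i j (n.val + 1) • baseVertex k i j
  | .inr (m, n) =>
      (tProd k i j m.val * sProd k i j n.val * rProd k i j 0) • baseVertex k i j

/-! ### The birational actions -/

/-- The multi-ratio of six points, with pairs of opposite points
`{x12, x34}`, `{x13, x24}`, `{x14, x23}`. -/
def multiRatio {F : Type*} [Field F] (x12 x13 x14 x23 x24 x34 : F) : F :=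
  ((x12 - x24) * (x13 - x23) * (x14 - x34)) / ((x12 - x23) * (x14 - x24) * (x13 - x34))

/-- The solution `x34` of `multiRatio x12 x13 x14 x23 x24 x34 = 1`,
see `multiRatio_eq_one_iff`. -/
def sixth {F : Type*} [Field F] (x12 x13 x14 x23 x24 : F) : F :=
  ((x12 - x23) * (x14 - x24) * x13 - (x12 - x24) * (x13 - x23) * x14) /
    ((x12 - x23) * (x14 - x24) - (x12 - x24) * (x13 - x23))

theorem multiRatio_eq_one_iff {F : Type*} [Field F] {x12 x13 x14 x23 x24 : F}
    (h1 : x12 ≠ x23) (h2 : x14 ≠ x24) (h3 : x13 ≠ x14) (h4 : x12 ≠ x24) (h5 : x13 ≠ x23)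
    (h : (x12 - x23) * (x14 - x24) - (x12 - x24) * (x13 - x23) ≠ 0) (z : F) :
    multiRatio x12 x13 x14 x23 x24 z = 1 ↔ z = sixth x12 x13 x14 x23 x24 := by
  have e1 := sub_ne_zero.2 h1
  have e2 := sub_ne_zero.2 h2
  have e3 := sub_ne_zero.2 h3
  have e4 := sub_ne_zero.2 h4
  have e5 := sub_ne_zero.2 h5
  constructor
  · intro hz
    have hd : (x12 - x23) * (x14 - x24) * (x13 - z) ≠ 0 := by
      intro h0
      simp [multiRatio, h0] at hz
    rw [multiRatio, div_eq_one_iff_eq hd] at hz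
    rw [sixth, eq_div_iff h]
    linear_combination hz
  · rintro hz
    have hm : z * ((x12 - x23) * (x14 - x24) - (x12 - x24) * (x13 - x23)) =
        (x12 - x23) * (x14 - x24) * x13 - (x12 - x24) * (x13 - x23) * x14 := by
      rw [hz, sixth, div_mul_cancel₀ _ h]
    have hx : x13 - z ≠ 0 := by
      intro h0
      have hz' : z = x13 := (sub_eq_zero.1 h0).symm
      have : (x12 - x24) * (x13 - x23) * (x13 - x14) = 0 := by
        rw [hz'] at hm
        linear_combination -hm
      exact mul_ne_zero (mul_ne_zero e4 e5) e3 this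
    rw [multiRatio, div_eq_one_iff_eq (mul_ne_zero (mul_ne_zero e1 e2) hx)]
    linear_combination hm

/-- The action of `r_0` on arrays: it exchanges `y_0` and `y_{00}`, and replaces `y_{mn}` with
`m, n ≥ 1` by the solution of the multi-ratio equation with opposite pairs
`{y_0, ȳ_{mn}}`, `{y_{0n}, y_{m0}}`, `{y_{00}, y_{mn}}`. -/
def actR0 {F : Type*} [Field F] {k i j : ℕ} (y : Pos k i j → F) : Pos k i j → F
  | .inl n => if n = 0 then y (.inr (0, 0)) else y (.inl n)
  | .inr (m, n) =>
      if m = 0 ∧ n = 0 then y (.inl 0)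
      else if m = 0 ∨ n = 0 then y (.inr (m, n))
      else sixth (y (.inl 0)) (y (.inr (0, n))) (y (.inr (0, 0))) (y (.inr (m, n)))
        (y (.inr (m, 0)))

/-- The actions of the generators on arrays: `r_n` (`n ≥ 1`) exchanges `y_{n-1}` and `y_n`, while
`t_m` and `s_n` exchange adjacent columns and rows of the second array. -/
def act {F : Type*} [Field F] {k i j : ℕ} : Node k i j → (Pos k i j → F) → (Pos k i j → F)
  | .inl n, y => Fin.cases (actR0 y)
      (fun n' => fun p => y (Sum.map (Equiv.swap n'.castSucc n'.succ) id p)) n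
  | .inr (.inl m), y => fun p => y (Sum.map id (Prod.map (Equiv.swap m.castSucc m.succ) id) p)
  | .inr (.inr n), y => fun p => y (Sum.map id (Prod.map id (Equiv.swap n.castSucc n.succ)) p)

/-- The field of rational functions over `ℂ` in the entries of the arrays. -/
abbrev RatField (k i j : ℕ) : Type := FractionRing (MvPolynomial (Pos k i j) ℂ)

/-- The arrays of variables. -/
noncomputable def var {k i j : ℕ} (p : Pos k i j) : RatField k i j :=
  algebraMap (MvPolynomial (Pos k i j) ℂ) (RatField k i j) (MvPolynomial.X p)

/-- The rational function `f` is regular at `y`, with value `z` there. -/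
def HasValueAt {k i j : ℕ} (f : RatField k i j) (y : Pos k i j → ℂ) (z : ℂ) : Prop :=
  ∃ p q : MvPolynomial (Pos k i j) ℂ, MvPolynomial.eval y q ≠ 0 ∧
    f = algebraMap _ (RatField k i j) p / algebraMap _ (RatField k i j) q ∧
    z = MvPolynomial.eval y p / MvPolynomial.eval y q

/-! ### Circle patterns in the inversive plane `ℂ ∪ {∞}` -/

/-- Circles of the inversive plane: Euclidean circles, and lines completed by `∞`. -/
def IsCircle (c : Set (OnePoint ℂ)) : Prop :=
  (∃ (z : ℂ) (r : ℝ), 0 < r ∧ c = (fun w : ℂ => (w : OnePoint ℂ)) '' Metric.sphere z r) ∨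
  (∃ p d : ℂ, d ≠ 0 ∧
    c = insert ∞ ((fun w : ℂ => (w : OnePoint ℂ)) '' {z | ∃ t : ℝ, z = p + (t : ℂ) * d}))

/-- The six points, with opposite pairs `{x12, x34}`, `{x13, x24}`, `{x14, x23}`, are points of a
(non-degenerate) Clifford `C₄` pattern of eight circles and eight points: the circles `c` through
the four faces of the octahedron avoiding an index concur at a point `P`, the circles `d` through
the four faces sharing an index concur at a point `Q`, and the eight circles, as well as the
eight points, are distinct. -/
def IsC4 (x12 x13 x14 x23 x24 x34 : OnePoint ℂ) : Prop :=
  ∃ (P Q : OnePoint ℂ) (c d : Fin 4 → Set (OnePoint ℂ)),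
    [x12, x13, x14, x23, x24, x34, P, Q].Nodup ∧
    Function.Injective (Sum.elim c d) ∧
    (∀ a, IsCircle (c a)) ∧ (∀ a, IsCircle (d a)) ∧
    ({x12, x23, x13} : Set (OnePoint ℂ)) ⊆ c 0 ∧ ({x23, x34, x24} : Set (OnePoint ℂ)) ⊆ c 1 ∧
    ({x13, x34, x14} : Set (OnePoint ℂ)) ⊆ c 2 ∧ ({x12, x24, x14} : Set (OnePoint ℂ)) ⊆ c 3 ∧
    (∀ a, P ∈ c a) ∧
    ({x12, x13, x14} : Set (OnePoint ℂ)) ⊆ d 0 ∧ ({x12, x23, x24} : Set (OnePoint ℂ)) ⊆ d 1 ∧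
    ({x13, x23, x34} : Set (OnePoint ℂ)) ⊆ d 2 ∧ ({x14, x24, x34} : Set (OnePoint ℂ)) ⊆ d 3 ∧
    (∀ a, Q ∈ d a)

/-- The octahedral cells of the figure are the images under the group of the octahedron with
vertices `y_0, y_{01}, y_{00}, y_{11}, y_{10}, r_0 y_{11}` (the orbit of `y_0` under the subgroup
generated by `r_0, t_1, s_1`). If `k = 0` these are the octahedral faces; in general they are the
octahedra spanned by three axes of a `k_{1,1}` cross-polytope. The map `x` satisfies the
constraint if it sends the vertices of each octahedral cell to points of a `C₄` pattern. -/
def C4Constraint {k i j : ℕ} (x : Vertex k i j → OnePoint ℂ) : Prop :=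
  ∀ w : W k i j,
    IsC4 (x (w • detVertex (.inl 0))) (x (w • detVertex (.inr (0, 1))))
      (x (w • detVertex (.inr (0, 0)))) (x (w • detVertex (.inr (1, 1))))
      (x (w • detVertex (.inr (1, 0)))) (x (w • (gen (.inl 0) : W k i j) • detVertex (.inr (1, 1))))

end GossetElte

open GossetElte

/-! The birational relations rest on one fact about Möbius maps. For `A = y_0`, `B = y_{0n}`, `C =
y_{00}`, `D = y_{m0}`, the new entry is the image of `y_{mn}` under the Möbius map that fixes `B`
and `D` and takes `A` to `C`. Composing such maps gives the involution and braid relations of `r_0`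
(`sixth_sixth`, `sixth_comp_left`, `sixth_comp_right`). They hold on nondegenerate arrays (`Reg`),
in particular on the array of variables, so the Coxeter group acts on the function field
(`birationalAction`).

To pass to vertices, the stabiliser of `y_k` has to be exactly the subgroup generated by the
generators other than `r_k`. These generators visibly fix `y_k`. For the converse, the action is
evaluated on arrays with `y_{mn} = y_{m0} + y_{0n} - y_{00}`, where it becomes the dual geometric
representation. Starting from a point of the open fundamental chamber, no root ever vanishes
(`rootValue_ne_zero`), so no denominator does, and the value of `y_k` strictly increases at each
`r_k` of a reduced word (`rootValue_none`). Hence vertices correspond to the orbit of `y_k`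
(`mk_eq_mk_iff`), and identities between vertices can be read off from variables.

The geometry is Menelaus' theorem. Inversion at `P` turns the four circles `c_a` into lines, so a
`C₄` pattern has multi-ratio one and its sixth point is determined (`IsC4.eq_sixth`). Conversely, if
the multi-ratio is one and no accidental collinearity or concyclicity occurs, both families of
circles concur (`OctNondeg.isC4`). The constraint therefore prescribes `r_0` on `y_{11}`; generators
commuting with `r_0` carry this to every `y_{mn}` with `m, n ≥ 1`, and induction on words gives
uniqueness (`c4Constraint_unique`).

General position means avoiding the zeros of one polynomial for each element of the group, pulling
nondegeneracy back along it, and of one for each pair of elements, separating distinct vertices.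
Conjugate variables enter because concyclicity is a real condition. Such a polynomial is shown to be
nonzero by exhibiting one good point (`RatOn.big_ne_zero`). -/

namespace GossetElte

/-! ### Algebra of the multi-ratio equation. -/

section SixthPoint
variable {F : Type*} [Field F]

/-- The denominator of `sixth`. -/
def sixthDen (A B C M D : F) : F := (A - M) * (C - D) - (A - D) * (B - M)

/-- The polynomial form of the equation `multiRatio x12 x13 x14 x23 x24 x34 = 1`. -/
def quadPoly (x12 x13 x14 x23 x24 x34 : F) : F :=
  (x12 - x24) * (x13 - x23) * (x14 - x34) - (x12 - x23) * (x14 - x24) * (x13 - x34)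

theorem sixth_mul_sixthDen {A B C M D : F} (h : sixthDen A B C M D ≠ 0) :
    sixth A B C M D * sixthDen A B C M D =
      (A - M) * (C - D) * B - (A - D) * (B - M) * C :=
  div_mul_cancel₀ _ h

theorem eq_sixth_iff {A B C M D X : F} (h : sixthDen A B C M D ≠ 0) :
    X = sixth A B C M D ↔ quadPoly A B C M D X = 0 := by
  have h1 := sixth_mul_sixthDen h
  constructor
  · rintro rfl
    unfold quadPoly
    unfold sixthDen at h1
    linear_combination h1
  · intro hq
    apply mul_right_cancel₀ h
    rw [h1]
    unfold quadPoly at hq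
    unfold sixthDen
    linear_combination hq

theorem quadPoly_sixth {A B C M D : F} (h : sixthDen A B C M D ≠ 0) :
    quadPoly A B C M D (sixth A B C M D) = 0 :=
  (eq_sixth_iff h).1 rfl

theorem sixth_transpose (A B C M D : F) : sixth A D C M B = sixth A B C M D := by
  unfold sixth
  congr 1 <;> ring

theorem sixthDen_transpose (A B C M D : F) : sixthDen A D C M B = sixthDen A B C M D := by
  unfold sixthDen
  ring

/-- The multi-ratio equation is symmetric under exchanging the opposite pairs `{x13, x24}` and
`{x14, x23}`. -/
theorem sixth_exchange (A B C M D : F) : sixth A M D B C = sixth A B C M D := by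
  unfold sixth
  rw [← neg_div_neg_eq]
  congr 1 <;> ring

/-- Since the product consists of differences of the fixed data only, nondegeneracy survives an
application of `r_0`. -/
theorem sixthDen_mul_sixthDen {A B C M D : F} (h : sixthDen A B C M D ≠ 0) :
    sixthDen A B C M D * sixthDen C B A (sixth A B C M D) D =
      (A - B) * (A - D) * ((C - B) * (C - D)) := by
  have h1 := sixth_mul_sixthDen h
  unfold sixthDen at h1 ⊢
  linear_combination (C - A) * h1

theorem sixthDen_sixth_ne_zero {A B C M D : F} (h : sixthDen A B C M D ≠ 0)
    (h1 : A ≠ B) (h2 : A ≠ D) (h3 : C ≠ B) (h4 : C ≠ D) :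
    sixthDen C B A (sixth A B C M D) D ≠ 0 := by
  intro h0
  have := sixthDen_mul_sixthDen h
  rw [h0, mul_zero, eq_comm] at this
  simp only [mul_eq_zero, sub_eq_zero] at this
  tauto

/-- The Möbius map fixing `B`, `D` and taking `C` to `A` is inverse to the one taking `A` to `C`;
accordingly `quadPoly` only changes sign. -/
theorem sixth_sixth {A B C M D : F} (h : sixthDen A B C M D ≠ 0)
    (h' : sixthDen C B A (sixth A B C M D) D ≠ 0) :
    sixth C B A (sixth A B C M D) D = M := by
  have h1 := quadPoly_sixth h
  symm
  rw [eq_sixth_iff h']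
  unfold quadPoly at h1 ⊢
  linear_combination -h1

/-- Among Möbius maps with fixed points `B`, `D`, the one with `A ↦ C` followed by the one with `E ↦
A` is the one with `E ↦ C`, because these maps commute. -/
theorem sixth_comp_left {A B C M D E : F} (h : sixthDen A B C M D ≠ 0)
    (h1 : sixthDen E B C M D ≠ 0) (h2 : sixthDen E B A (sixth A B C M D) D ≠ 0) :
    sixth E B A (sixth A B C M D) D = sixth E B C M D := by
  symm
  rw [eq_sixth_iff h2]
  have hN := sixth_mul_sixthDen h
  have hZ := sixth_mul_sixthDen h1
  generalize sixth A B C M D = N at *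
  generalize sixth E B C M D = Z at *
  apply (mul_eq_zero.1 (?_ : sixthDen A B C M D * sixthDen E B C M D * _ = 0)).resolve_left
    (mul_ne_zero h h1)
  unfold quadPoly
  unfold sixthDen at *
  linear_combination
    ((E - M) * (C - D) - (E - D) * (B - M)) * ((A - D) * (B - Z) - (E - D) * (A - Z)) * hN +
    ((E * ((A - M) * (C - D) - (A - D) * (B - M)) -
        ((A - M) * (C - D) * B - (A - D) * (B - M) * C)) * (A - D) -
      (E - D) * (B * ((A - M) * (C - D) - (A - D) * (B - M)) -
        ((A - M) * (C - D) * B - (A - D) * (B - M) * C))) * hZ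

/-- Two Möbius maps sharing the fixed point `D` compose to one that fixes `D` and takes `A` to `C`
and then to `G`. The equation defining `sixth A B C E G` says that its other fixed point is `E`. -/
theorem sixth_comp_right {A B C M D E G : F} (h : sixthDen A B C M D ≠ 0)
    (h1 : sixthDen A B C E G ≠ 0) (h2 : sixthDen A E G M D ≠ 0)
    (h3 : sixthDen C (sixth A B C E G) G (sixth A B C M D) D ≠ 0) :
    sixth C (sixth A B C E G) G (sixth A B C M D) D = sixth A E G M D := by
  symm
  rw [eq_sixth_iff h3]
  have hN := sixth_mul_sixthDen h
  have hX := sixth_mul_sixthDen h1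
  have hZ := sixth_mul_sixthDen h2
  generalize sixth A B C M D = N at *
  generalize sixth A B C E G = X at *
  generalize sixth A E G M D = Z at *
  apply (mul_eq_zero.1 (?_ : sixthDen A B C E G * sixthDen A B C M D * sixthDen A E G M D * _
    = 0)).resolve_left (mul_ne_zero (mul_ne_zero h1 h) h2)
  obtain ⟨nN, hnN⟩ : ∃ n, n = (A - M) * (C - D) * B - (A - D) * (B - M) * C := ⟨_, rfl⟩
  obtain ⟨nX, hnX⟩ : ∃ n, n = (A - E) * (C - G) * B - (A - G) * (B - E) * C := ⟨_, rfl⟩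
  obtain ⟨nZ, hnZ⟩ : ∃ n, n = (A - M) * (G - D) * E - (A - D) * (E - M) * G := ⟨_, rfl⟩
  -- This is the goal with the three new points written as fractions and the denominators cleared.
  -- Once it is known, numerators and denominators can be made opaque.
  have key : (C - D) * (nX * sixthDen A B C M D - sixthDen A B C E G * nN) *
        (G * sixthDen A E G M D - nZ) -
      (C * sixthDen A B C M D - nN) * (G - D) *
        (nX * sixthDen A E G M D - sixthDen A B C E G * nZ) = 0 := by
    subst hnN hnX hnZ
    unfold sixthDen
    ring
  rw [← hnN] at hN
  rw [← hnX] at hX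
  rw [← hnZ] at hZ
  generalize sixthDen A B C M D = dN at *
  generalize sixthDen A B C E G = dX at *
  generalize sixthDen A E G M D = dZ at *
  unfold quadPoly
  linear_combination dN * dZ * ((C - D) * (G - Z) - (C - N) * (G - D)) * hX +
    dZ * (-(C - D) * dX * (G - Z) + (G - D) * (nX - dX * Z)) * hN +
    (-(C - D) * (nX * dN - dX * nN) + (C * dN - nN) * (G - D) * dX) * hZ + key

end SixthPoint

/-! ### Coxeter relations for the actions on arrays. -/

section ArrayActions
variable {F : Type*} [Field F] {k i j : ℕ}

section R0

/-- The conditions under which `r_0` acts on an array without degeneration. -/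
def Reg (y : Pos k i j → F) : Prop :=
  ∀ (m : Fin (i + 1)) (n : Fin (j + 1)), m ≠ 0 → n ≠ 0 →
    (y (.inl 0) ≠ y (.inr (0, n)) ∧ y (.inl 0) ≠ y (.inr (m, 0)) ∧
      y (.inr (0, 0)) ≠ y (.inr (0, n)) ∧ y (.inr (0, 0)) ≠ y (.inr (m, 0))) ∧
    sixthDen (y (.inl 0)) (y (.inr (0, n))) (y (.inr (0, 0))) (y (.inr (m, n)))
      (y (.inr (m, 0))) ≠ 0

@[simp] theorem actR0_inl_zero (y : Pos k i j → F) : actR0 y (.inl 0) = y (.inr (0, 0)) := by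
  simp [actR0]

theorem actR0_inl (y : Pos k i j → F) {n : Fin (k + 1)} (hn : n ≠ 0) :
    actR0 y (.inl n) = y (.inl n) := by
  simp [actR0, hn]

@[simp] theorem actR0_zero_zero (y : Pos k i j → F) : actR0 y (.inr (0, 0)) = y (.inl 0) := by
  simp [actR0]

theorem actR0_zero_right (y : Pos k i j → F) {m : Fin (i + 1)} (hm : m ≠ 0) :
    actR0 y (.inr (m, 0)) = y (.inr (m, 0)) := by
  simp [actR0, hm]

theorem actR0_zero_left (y : Pos k i j → F) {n : Fin (j + 1)} (hn : n ≠ 0) :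
    actR0 y (.inr (0, n)) = y (.inr (0, n)) := by
  simp [actR0, hn]

theorem actR0_inr (y : Pos k i j → F) {m : Fin (i + 1)} {n : Fin (j + 1)} (hm : m ≠ 0)
    (hn : n ≠ 0) :
    actR0 y (.inr (m, n)) = sixth (y (.inl 0)) (y (.inr (0, n))) (y (.inr (0, 0)))
      (y (.inr (m, n))) (y (.inr (m, 0))) := by
  simp [actR0, hm, hn]

theorem Reg.actR0 {y : Pos k i j → F} (h : Reg y) : Reg (actR0 y) := by
  intro m n hm hn
  obtain ⟨⟨h1, h2, h3, h4⟩, h5⟩ := h m n hm hn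
  simp only [actR0_inl_zero, actR0_zero_zero, actR0_zero_left _ hn, actR0_zero_right _ hm,
    actR0_inr _ hm hn]
  exact ⟨⟨h3, h4, h1, h2⟩, sixthDen_sixth_ne_zero h5 h1 h2 h3 h4⟩

theorem actR0_actR0 {y : Pos k i j → F} (h : Reg y) : actR0 (actR0 y) = y := by
  funext p
  rcases p with n | ⟨m, n⟩
  · by_cases hn : n = 0
    · subst hn; simp
    · rw [actR0_inl _ hn, actR0_inl _ hn]
  · by_cases hm : m = 0 <;> by_cases hn : n = 0
    · subst hm hn; simp
    · subst hm; rw [actR0_zero_left _ hn, actR0_zero_left _ hn]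
    · subst hn; rw [actR0_zero_right _ hm, actR0_zero_right _ hm]
    · have h1 := (h m n hm hn).2
      have h2 := (h.actR0 m n hm hn).2
      rw [actR0_inr _ hm hn]
      simp only [actR0_inl_zero, actR0_zero_zero, actR0_zero_left _ hn, actR0_zero_right _ hm,
        actR0_inr _ hm hn] at h2 ⊢
      exact sixth_sixth h1 h2

/-- The exchange of `y_0` and `y_c`. -/
def swapHead {F : Type*} (c : Fin (k + 1)) (y : Pos k i j → F) : Pos k i j → F :=
  fun p => y (Sum.map (Equiv.swap 0 c) id p)

/-- The exchange of the columns `0` and `c`. -/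
def swapCol {F : Type*} (c : Fin (i + 1)) (y : Pos k i j → F) : Pos k i j → F :=
  fun p => y (Sum.map id (Prod.map (Equiv.swap 0 c) id) p)

/-- The exchange of the rows `0` and `c`. -/
def swapRow {F : Type*} (c : Fin (j + 1)) (y : Pos k i j → F) : Pos k i j → F :=
  fun p => y (Sum.map id (Prod.map id (Equiv.swap 0 c)) p)

/-- The array with the rows and columns of its second part exchanged. -/
def flip {F : Type*} (y : Pos k i j → F) : Pos k j i → F := fun p => y (Sum.map id Prod.swap p)

theorem flip_flip {F : Type*} (y : Pos k i j → F) : flip (flip y) = y := by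
  funext p
  rcases p with n | ⟨m, n⟩ <;> rfl

theorem flip_swapCol {F : Type*} (c : Fin (i + 1)) (y : Pos k i j → F) :
    flip (swapCol c y) = swapRow c (flip y) := by
  funext p
  rcases p with n | ⟨m, n⟩ <;> rfl

theorem flip_swapRow {F : Type*} (c : Fin (j + 1)) (y : Pos k i j → F) :
    flip (swapRow c y) = swapCol c (flip y) := by
  funext p
  rcases p with n | ⟨m, n⟩ <;> rfl

theorem flip_actR0 (y : Pos k i j → F) : flip (actR0 y) = actR0 (flip y) := by
  funext p
  rcases p with n | ⟨n, m⟩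
  · rfl
  · change actR0 y (.inr (m, n)) = _
    by_cases hm : m = 0 <;> by_cases hn : n = 0
    · subst hm hn; simp [flip]
    · subst hm; rw [actR0_zero_left _ hn, actR0_zero_right _ hn]; rfl
    · subst hn; rw [actR0_zero_right _ hm, actR0_zero_left _ hm]; rfl
    · rw [actR0_inr _ hm hn, actR0_inr _ hn hm, sixth_transpose]; rfl

theorem Reg.flip {y : Pos k i j → F} (h : Reg y) : Reg (flip y) := by
  intro m n hm hn
  obtain ⟨⟨h1, h2, h3, h4⟩, h5⟩ := h n m hn hm
  refine ⟨⟨h2, h1, h4, h3⟩, ?_⟩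
  rw [sixthDen_transpose]
  exact h5

/-- For an entry with `m, n ≥ 1` the exchange changes only `y_0`, so all the Möbius maps involved
have the same fixed points. -/
theorem actR0_braid_swapHead {c : Fin (k + 1)} (hc : c ≠ 0) {y : Pos k i j → F} (h : Reg y)
    (h1 : Reg (swapHead c y)) (h2 : Reg (swapHead c (actR0 y))) :
    actR0 (swapHead c (actR0 y)) = swapHead c (actR0 (swapHead c y)) := by
  funext p
  rcases p with n | ⟨m, n⟩
  · by_cases hn : n = 0
    · subst hn
      simp [swapHead, actR0_inl _ hc]
    · by_cases hnc : n = c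
      · subst hnc
        rw [actR0_inl _ hn]
        simp [swapHead]
      · rw [actR0_inl _ hn]
        simp [swapHead, Equiv.swap_apply_of_ne_of_ne hn hnc, actR0_inl _ hn]
  · by_cases hm : m = 0 <;> by_cases hn : n = 0
    · subst hm hn; simp [swapHead, actR0_inl _ hc]
    · subst hm; simp [swapHead, actR0_zero_left _ hn]
    · subst hn; simp [swapHead, actR0_zero_right _ hm]
    · have e := (h m n hm hn).2
      have e1 := (h1 m n hm hn).2
      have e2 := (h2 m n hm hn).2
      simp only [swapHead, Sum.map_inl, Sum.map_inr, id, Equiv.swap_apply_left,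
        actR0_zero_zero, actR0_zero_left _ hn, actR0_zero_right _ hm, actR0_inr _ hm hn,
        actR0_inl _ hc] at e e1 e2 ⊢
      exact sixth_comp_left e e1 e2

/-- In the rows `n ≥ 1` there are three mechanisms: the symmetry `sixth_exchange` in column `0`, the
involution `sixth_sixth` in column `c`, and the composition `sixth_comp_right` in the other columns.
-/
theorem actR0_braid_swapCol {c : Fin (i + 1)} (hc : c ≠ 0) {y : Pos k i j → F} (h : Reg y)
    (h1 : Reg (swapCol c y)) (h2 : Reg (swapCol c (actR0 y))) :
    actR0 (swapCol c (actR0 y)) = swapCol c (actR0 (swapCol c y)) := by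
  funext p
  rcases p with n | ⟨m, n⟩
  · by_cases hn : n = 0
    · subst hn
      simp [swapCol, actR0_zero_right _ hc]
    · simp [swapCol, actR0_inl _ hn]
  · by_cases hm : m = 0
    · subst hm
      by_cases hn : n = 0
      · subst hn; simp [swapCol, actR0_zero_right _ hc]
      · rw [actR0_zero_left _ hn]
        simp only [swapCol, Sum.map_inr, Prod.map, id, Equiv.swap_apply_left, Sum.map_inl,
          actR0_inr _ hc hn, Equiv.swap_apply_right]
        rw [sixth_exchange]
    · by_cases hmc : m = c
      · subst hmc
        by_cases hn : n = 0
        · subst hn; rw [actR0_zero_right _ hm]; simp [swapCol]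
        · have e := (h m n hm hn).2
          have e1 := (h.actR0 m n hm hn).2
          simp only [swapCol, Sum.map_inl, Sum.map_inr, Prod.map, id, Equiv.swap_apply_left,
            Equiv.swap_apply_right, actR0_inl_zero,
            actR0_zero_zero, actR0_zero_left _ hn, actR0_zero_right _ hm, actR0_inr _ hm hn]
            at e e1 ⊢
          rw [sixth_exchange]
          exact sixth_sixth e e1
      · by_cases hn : n = 0
        · subst hn; simp [swapCol, actR0_zero_right _ hm, Equiv.swap_apply_of_ne_of_ne hm hmc]
        · have e := (h m n hm hn).2
          have e' := (h c n hc hn).2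
          have e1 := (h1 m n hm hn).2
          have e2 := (h2 m n hm hn).2
          simp only [swapCol, Sum.map_inl, Sum.map_inr, Prod.map, id, Equiv.swap_apply_left,
            Equiv.swap_apply_of_ne_of_ne hm hmc, actR0_inl_zero, actR0_zero_right _ hm,
            actR0_zero_right _ hc,
            actR0_inr _ hm hn, actR0_inr _ hc hn] at e e' e1 e2 ⊢
          exact sixth_comp_right e e' e1 e2

theorem actR0_braid_swapRow {c : Fin (j + 1)} (hc : c ≠ 0) {y : Pos k i j → F} (h : Reg y)
    (h1 : Reg (swapRow c y)) (h2 : Reg (swapRow c (actR0 y))) :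
    actR0 (swapRow c (actR0 y)) = swapRow c (actR0 (swapRow c y)) := by
  have h1' := h1.flip
  have h2' := h2.flip
  rw [flip_swapRow] at h1' h2'
  rw [flip_actR0] at h2'
  have := congrArg flip (actR0_braid_swapCol hc h.flip h1' h2')
  simpa only [flip_swapCol, flip_actR0, flip_flip] using this

end R0

section Relations

/-- The permutation of the positions given by a generator other than `r_0`. -/
def nodePerm : Node k i j → Equiv.Perm (Pos k i j)
  | .inl n => Fin.cases 1
      (fun n' => Equiv.sumCongr (Equiv.swap n'.castSucc n'.succ) (Equiv.refl _)) n
  | .inr (.inl m) => Equiv.sumCongr (Equiv.refl _)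
      (Equiv.prodCongr (Equiv.swap m.castSucc m.succ) (Equiv.refl _))
  | .inr (.inr n) => Equiv.sumCongr (Equiv.refl _)
      (Equiv.prodCongr (Equiv.refl _) (Equiv.swap n.castSucc n.succ))

theorem act_zero (y : Pos k i j → F) : act (.inl 0) y = actR0 y := rfl

theorem act_apply {a : Node k i j} (ha : a ≠ .inl 0) (y : Pos k i j → F) (p : Pos k i j) :
    act a y p = y (nodePerm a p) := by
  rcases a with n | m | n
  · induction n using Fin.cases with
    | zero => exact absurd rfl ha
    | succ n => rcases p with p | p <;> rfl
  · rcases p with p | p <;> rfl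
  · rcases p with p | p <;> rfl

theorem nodePerm_mul_self (a : Node k i j) : nodePerm a * nodePerm a = 1 := by
  ext p : 1
  rcases a with n | m | n
  · induction n using Fin.cases with
    | zero => rfl
    | succ n => rcases p with p | p <;> simp [nodePerm]
  · rcases p with p | p <;> simp [nodePerm, Prod.map]
  · rcases p with p | p <;> simp [nodePerm, Prod.map]

theorem swap_braid {N : ℕ} {a b : Fin N} (h : a.val + 1 = b.val) (p : Fin (N + 1)) :
    Equiv.swap a.castSucc a.succ (Equiv.swap b.castSucc b.succ (Equiv.swap a.castSucc a.succ p)) =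
    Equiv.swap b.castSucc b.succ (Equiv.swap a.castSucc a.succ (Equiv.swap b.castSucc b.succ p)) := by
  have e : a.succ = b.castSucc := by ext; simp [h]
  have h1 : a.castSucc ≠ b.castSucc := by simp [Fin.ext_iff]; omega
  have h2 : a.castSucc ≠ b.succ := by simp [Fin.ext_iff]; omega
  have h3 : b.castSucc ≠ b.succ := by simp [Fin.ext_iff]
  rw [e]
  have h' := Equiv.swap_mul_swap_mul_swap h3.symm h2.symm
  rw [Equiv.swap_comm b.succ, Equiv.swap_comm b.castSucc a.castSucc] at h'
  exact DFunLike.congr_fun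
    (h'.trans ((Equiv.swap_comm _ _).trans (Equiv.swap_mul_swap_mul_swap h1 h2).symm)) p

theorem swap_commute {N : ℕ} {a b : Fin N} (hab : a ≠ b) (h : a.val + 1 ≠ b.val)
    (h' : b.val + 1 ≠ a.val) (p : Fin (N + 1)) :
    Equiv.swap a.castSucc a.succ (Equiv.swap b.castSucc b.succ p) =
    Equiv.swap b.castSucc b.succ (Equiv.swap a.castSucc a.succ p) := by
  have h0 : a.val ≠ b.val := fun h => hab (Fin.ext h)
  have : Equiv.Perm.Disjoint (Equiv.swap a.castSucc a.succ) (Equiv.swap b.castSucc b.succ) := by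
    intro x
    by_cases hx : x = a.castSucc ∨ x = a.succ
    · right
      apply Equiv.swap_apply_of_ne_of_ne <;> rintro rfl <;> simp [Fin.ext_iff] at hx <;> omega
    · left
      push Not at hx
      exact Equiv.swap_apply_of_ne_of_ne hx.1 hx.2
  exact DFunLike.congr_fun this.commute.eq p

theorem nodePerm_braid {a b : Node k i j} (ha : a ≠ .inl 0) (hb : b ≠ .inl 0) (h : Link a b) :
    nodePerm a * nodePerm b * nodePerm a = nodePerm b * nodePerm a * nodePerm b := by
  ext p : 1
  rcases a with a | a | a <;> rcases b with b | b | b <;> simp only [Link] at h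
  · induction a using Fin.cases with
    | zero => exact absurd rfl ha
    | succ a =>
      induction b using Fin.cases with
      | zero => exact absurd rfl hb
      | succ b =>
        rcases p with p | p
        · exact congrArg Sum.inl (swap_braid (by simpa using h) p)
        · rfl
  · exact absurd (congrArg Sum.inl (Fin.ext h.1)) ha
  · exact absurd (congrArg Sum.inl (Fin.ext h.1)) ha
  · rcases p with p | p
    · rfl
    · exact congrArg (fun x => Sum.inr (x, p.2)) (swap_braid h p.1)
  · rcases p with p | p
    · rfl
    · exact congrArg (fun x => Sum.inr (p.1, x)) (swap_braid h p.2)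

theorem nodePerm_commute {a b : Node k i j} (ha : a ≠ .inl 0) (hb : b ≠ .inl 0) (hab : a ≠ b)
    (h : ¬ Link a b) (h' : ¬ Link b a) : nodePerm a * nodePerm b = nodePerm b * nodePerm a := by
  ext p : 1
  rcases a with a | a | a <;> rcases b with b | b | b <;> simp only [Link] at h h'
  · induction a using Fin.cases with
    | zero => exact absurd rfl ha
    | succ a =>
      induction b using Fin.cases with
      | zero => exact absurd rfl hb
      | succ b =>
        rcases p with p | p
        · exact congrArg Sum.inl (swap_commute (by simpa using hab) (by simpa using h)
            (by simpa using h') p)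
        · rfl
  · induction a using Fin.cases with
    | zero => exact absurd rfl ha
    | succ a => rcases p with p | p <;> rfl
  · induction a using Fin.cases with
    | zero => exact absurd rfl ha
    | succ a => rcases p with p | p <;> rfl
  · induction b using Fin.cases with
    | zero => exact absurd rfl hb
    | succ b => rcases p with p | p <;> rfl
  · rcases p with p | p
    · rfl
    · exact congrArg (fun x => Sum.inr (x, p.2)) (swap_commute (by simpa using hab) h h' p.1)
  · rcases p with p | p <;> rfl
  · induction b using Fin.cases with
    | zero => exact absurd rfl hb
    | succ b => rcases p with p | p <;> rfl
  · rcases p with p | p <;> rfl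
  · rcases p with p | p
    · rfl
    · exact congrArg (fun x => Sum.inr (p.1, x)) (swap_commute (by simpa using hab) h h' p.2)

/-- The formula for `r_0` singles out only the index `0` of each range, and a generator not linked
to `r_0` permutes indices fixing `0`. -/
theorem actR0_commute {b : Node k i j} (hb : b ≠ .inl 0) (h : ¬ Link (.inl 0) b)
    (y : Pos k i j → F) : actR0 (act b y) = act b (actR0 y) := by
  rcases b with b | b | b <;> simp only [Link] at h
  · induction b using Fin.cases with
    | zero => exact absurd rfl hb
    | succ b =>
      have h0 : b.castSucc ≠ 0 := by
        intro h1
        apply h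
        simpa [Fin.ext_iff, eq_comm] using h1
      have h1 : b.succ ≠ 0 := Fin.succ_ne_zero b
      have e : ∀ x, Equiv.swap b.castSucc b.succ x = 0 ↔ x = 0 := by
        intro x
        rw [Equiv.swap_apply_eq_iff, Equiv.swap_apply_of_ne_of_ne h0.symm h1.symm]
      have e0 := (e 0).2 rfl
      funext p
      rcases p with p | ⟨m, n⟩
      · by_cases hp : p = 0 <;> simp [act, actR0, hp, e, e0]
      · simp [act, actR0, e0]
  · have h0 : b.castSucc ≠ 0 := by
      intro h1
      apply h
      simpa [Fin.ext_iff] using h1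
    have h1 : b.succ ≠ 0 := Fin.succ_ne_zero b
    have e : ∀ x, Equiv.swap b.castSucc b.succ x = 0 ↔ x = 0 := by
      intro x
      rw [Equiv.swap_apply_eq_iff, Equiv.swap_apply_of_ne_of_ne h0.symm h1.symm]
    have e0 := (e 0).2 rfl
    funext p
    rcases p with p | ⟨m, n⟩
    · simp [act, actR0, e0]
    · simp [act, actR0, e, e0]
  · have h0 : b.castSucc ≠ 0 := by
      intro h1
      apply h
      simpa [Fin.ext_iff] using h1
    have h1 : b.succ ≠ 0 := Fin.succ_ne_zero b
    have e : ∀ x, Equiv.swap b.castSucc b.succ x = 0 ↔ x = 0 := by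
      intro x
      rw [Equiv.swap_apply_eq_iff, Equiv.swap_apply_of_ne_of_ne h0.symm h1.symm]
    have e0 := (e 0).2 rfl
    funext p
    rcases p with p | ⟨m, n⟩
    · simp [act, actR0, e0]
    · simp [act, actR0, e, e0]

theorem actR0_braid {b : Node k i j} (h : Link (.inl 0) b) {y : Pos k i j → F} (hy : Reg y)
    (h1 : Reg (act b y)) (h2 : Reg (act b (actR0 y))) :
    actR0 (act b (actR0 y)) = act b (actR0 (act b y)) := by
  rcases b with b | b | b <;> simp only [Link] at h
  · induction b using Fin.cases with
    | zero => simp at h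
    | succ b =>
      have e : (act (.inl b.succ) : (Pos k i j → F) → _) = swapHead b.succ := by
        have : b.castSucc = 0 := by simpa [Fin.ext_iff] using h.symm
        funext y
        simp only [act, Fin.cases_succ, this]
        rfl
      rw [e] at h1 h2 ⊢
      exact actR0_braid_swapHead (Fin.succ_ne_zero b) hy h1 h2
  · have e : (act (.inr (.inl b)) : (Pos k i j → F) → _) = swapCol b.succ := by
      have : b.castSucc = 0 := by simpa [Fin.ext_iff] using h
      funext y
      simp only [act, this]
      rfl
    rw [e] at h1 h2 ⊢
    exact actR0_braid_swapCol (Fin.succ_ne_zero b) hy h1 h2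
  · have e : (act (.inr (.inr b)) : (Pos k i j → F) → _) = swapRow b.succ := by
      have : b.castSucc = 0 := by simpa [Fin.ext_iff] using h
      funext y
      simp only [act, this]
      rfl
    rw [e] at h1 h2 ⊢
    exact actR0_braid_swapRow (Fin.succ_ne_zero b) hy h1 h2

theorem act_act_self {a : Node k i j} {y : Pos k i j → F} (hy : a = .inl 0 → Reg y) :
    act a (act a y) = y := by
  by_cases ha : a = .inl 0
  · subst ha
    exact actR0_actR0 (hy rfl)
  · funext p
    rw [act_apply ha, act_apply ha, ← Equiv.Perm.mul_apply, nodePerm_mul_self]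
    rfl

theorem act_commute {a b : Node k i j} (hab : a ≠ b) (h : ¬ Link a b) (h' : ¬ Link b a)
    (y : Pos k i j → F) : act a (act b y) = act b (act a y) := by
  by_cases ha : a = .inl 0
  · subst ha
    exact actR0_commute hab.symm h y
  by_cases hb : b = .inl 0
  · subst hb
    exact (actR0_commute hab h' y).symm
  funext p
  rw [act_apply ha, act_apply hb, act_apply hb, act_apply ha, ← Equiv.Perm.mul_apply,
    nodePerm_commute hb ha hab.symm h' h]
  rfl

/-- Links are directed away from `r_0`, so `r_0` can occur only as `a`, and only then is
nondegeneracy needed. -/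
theorem act_braid {a b : Node k i j} (h : Link a b) {y : Pos k i j → F}
    (hy : a = .inl 0 → Reg y ∧ Reg (act b y) ∧ Reg (act b (act a y))) :
    act a (act b (act a y)) = act b (act a (act b y)) := by
  by_cases ha : a = .inl 0
  · subst ha
    exact actR0_braid h (hy rfl).1 (hy rfl).2.1 (hy rfl).2.2
  have hb : b ≠ .inl 0 := by
    rintro rfl
    rcases a with a | a | a <;> simp [Link] at h
  funext p
  have := DFunLike.congr_fun (nodePerm_braid ha hb h) p
  simp only [Equiv.Perm.mul_apply] at this
  rw [act_apply ha, act_apply hb, act_apply ha, act_apply hb, act_apply ha, act_apply hb, this]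

end Relations

end ArrayActions

/-! ### Generic sets for polynomials in coordinates and their conjugates. -/

section General
variable {ι : Type*}

/-- The value of a polynomial in variables and their complex conjugates. -/
noncomputable def conjEval (y : ι → ℂ) : MvPolynomial (ι ⊕ ι) ℂ →+* ℂ :=
  MvPolynomial.eval (Sum.elim y fun p => starRingEnd ℂ (y p))

/-- Sets of complex vectors containing the complement of the zero set of a nonzero polynomial in
the coordinates and their complex conjugates. -/
def Big (U : Set (ι → ℂ)) : Prop :=
  ∃ f : MvPolynomial (ι ⊕ ι) ℂ, f ≠ 0 ∧ ∀ y, conjEval y f ≠ 0 → y ∈ U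

/-- Substituting `u + iv` for a variable and `u - iv` for its conjugate gives a polynomial that
would vanish at all real `u, v`, hence identically; the substitution is invertible over `ℂ`. -/
theorem exists_conjEval_ne_zero {f : MvPolynomial (ι ⊕ ι) ℂ} (hf : f ≠ 0) :
    ∃ y, conjEval y f ≠ 0 := by
  by_contra! h
  apply hf
  let q : MvPolynomial (ι ⊕ ι) ℂ := MvPolynomial.bind₁ (Sum.elim
    (fun p => MvPolynomial.X (.inl p) + MvPolynomial.C Complex.I * MvPolynomial.X (.inr p))
    (fun p => MvPolynomial.X (.inl p) - MvPolynomial.C Complex.I * MvPolynomial.X (.inr p))) f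
  have hq (v : ι ⊕ ι → ℂ) : MvPolynomial.eval v q = MvPolynomial.eval (Sum.elim
      (fun p => v (.inl p) + Complex.I * v (.inr p))
      (fun p => v (.inl p) - Complex.I * v (.inr p))) f := by
    change MvPolynomial.eval₂Hom (RingHom.id ℂ) v q = _
    rw [MvPolynomial.eval₂Hom_bind₁]
    change _ = MvPolynomial.eval₂Hom (RingHom.id ℂ) _ f
    congr 2
    funext p
    rcases p with p | p <;> simp
  have hq0 : q = 0 := by
    refine MvPolynomial.funext_set (fun _ => Set.range ((↑) : ℝ → ℂ))
      (fun _ => Set.infinite_range_of_injective Complex.ofReal_injective) fun v hv => ?_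
    choose u hu using fun p => hv p trivial
    obtain rfl : (fun p => (u p : ℂ)) = v := funext hu
    rw [hq, map_zero]
    refine Eq.trans ?_ (h fun p => (u (.inl p) : ℂ) + Complex.I * u (.inr p))
    unfold conjEval
    congr 2
    funext p
    simp [sub_eq_add_neg]
  -- The inverse substitution is `u = (z + z') / 2`, `v = (z - z') / (2i)`, with `z` and `z'`
  -- independent.
  refine MvPolynomial.funext fun v => ?_
  have := hq (Sum.elim (fun p => (v (.inl p) + v (.inr p)) / 2)
    (fun p => (v (.inl p) - v (.inr p)) / (2 * Complex.I)))
  rw [hq0, map_zero] at this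
  rw [map_zero, this]
  congr 2
  funext p
  rcases p with p | p <;> simp <;> field_simp <;> ring

theorem Big.nonempty {U : Set (ι → ℂ)} (h : Big U) : U.Nonempty := by
  obtain ⟨f, hf, h⟩ := h
  obtain ⟨y, hy⟩ := exists_conjEval_ne_zero hf
  exact ⟨y, h y hy⟩

theorem Big.mono {U V : Set (ι → ℂ)} (h : Big U) (hUV : U ⊆ V) : Big V := by
  obtain ⟨f, hf, h⟩ := h
  exact ⟨f, hf, fun y hy => hUV (h y hy)⟩

theorem big_univ : Big (Set.univ : Set (ι → ℂ)) := ⟨1, one_ne_zero, fun _ _ => trivial⟩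

theorem Big.inter {U V : Set (ι → ℂ)} (hU : Big U) (hV : Big V) : Big (U ∩ V) := by
  obtain ⟨f, hf, h⟩ := hU
  obtain ⟨g, hg, h'⟩ := hV
  refine ⟨f * g, mul_ne_zero hf hg, fun y hy => ?_⟩
  rw [map_mul] at hy
  exact ⟨h y (left_ne_zero_of_mul hy), h' y (right_ne_zero_of_mul hy)⟩

theorem Big.iInter {α : Type*} [Finite α] {U : α → Set (ι → ℂ)} (h : ∀ a, Big (U a)) :
    Big {y | ∀ a, y ∈ U a} := by
  cases nonempty_fintype α
  choose f hf h using h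
  refine ⟨∏ a, f a, Finset.prod_ne_zero_iff.2 fun a _ => hf a, fun y hy a => h a y ?_⟩
  rw [map_prod] at hy
  exact Finset.prod_ne_zero_iff.1 hy a (Finset.mem_univ a)

/-- Functions given on a set by a rational function of the coordinates and their conjugates. -/
def RatOn (R : Set (ι → ℂ)) (φ : (ι → ℂ) → ℂ) : Prop :=
  ∃ q d : MvPolynomial (ι ⊕ ι) ℂ, ∀ y ∈ R, conjEval y d ≠ 0 ∧ conjEval y q = φ y * conjEval y d

variable {R : Set (ι → ℂ)} {φ ψ : (ι → ℂ) → ℂ}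

theorem ratOn_const (c : ℂ) : RatOn R (fun _ => c) :=
  ⟨MvPolynomial.C c, 1, fun y _ => by simp [conjEval]⟩

theorem ratOn_apply (p : ι) : RatOn R (fun y => y p) :=
  ⟨MvPolynomial.X (.inl p), 1, fun y _ => by simp [conjEval]⟩

theorem RatOn.add (h : RatOn R φ) (h' : RatOn R ψ) : RatOn R (fun y => φ y + ψ y) := by
  obtain ⟨q, d, h⟩ := h
  obtain ⟨q', d', h'⟩ := h'
  refine ⟨q * d' + q' * d, d * d', fun y hy => ?_⟩
  simp only [map_mul, map_add]
  refine ⟨mul_ne_zero (h y hy).1 (h' y hy).1, ?_⟩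
  rw [(h y hy).2, (h' y hy).2]
  ring

theorem RatOn.mul (h : RatOn R φ) (h' : RatOn R ψ) : RatOn R (fun y => φ y * ψ y) := by
  obtain ⟨q, d, h⟩ := h
  obtain ⟨q', d', h'⟩ := h'
  refine ⟨q * q', d * d', fun y hy => ?_⟩
  simp only [map_mul]
  refine ⟨mul_ne_zero (h y hy).1 (h' y hy).1, ?_⟩
  rw [(h y hy).2, (h' y hy).2]
  ring

theorem RatOn.sub (h : RatOn R φ) (h' : RatOn R ψ) : RatOn R (fun y => φ y - ψ y) := by
  simpa [sub_eq_add_neg] using h.add ((ratOn_const (-1)).mul h')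

theorem RatOn.inv (h : RatOn R φ) (h0 : ∀ y ∈ R, φ y ≠ 0) : RatOn R (fun y => (φ y)⁻¹) := by
  obtain ⟨q, d, h⟩ := h
  refine ⟨d, q, fun y hy => ?_⟩
  have := h0 y hy
  rw [(h y hy).2]
  refine ⟨mul_ne_zero this (h y hy).1, ?_⟩
  field_simp

theorem RatOn.div (h : RatOn R φ) (h' : RatOn R ψ) (h0 : ∀ y ∈ R, ψ y ≠ 0) :
    RatOn R (fun y => φ y / ψ y) := by
  simpa [div_eq_mul_inv] using h.mul (h'.inv h0)

theorem conjEval_swap (f : MvPolynomial (ι ⊕ ι) ℂ) (y : ι → ℂ) :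
    conjEval y (MvPolynomial.rename Sum.swap (MvPolynomial.map (starRingEnd ℂ) f)) =
      starRingEnd ℂ (conjEval y f) := by
  unfold conjEval
  rw [MvPolynomial.eval_rename, MvPolynomial.eval_map]
  change _ = starRingEnd ℂ (MvPolynomial.eval₂ (RingHom.id ℂ) _ f)
  rw [MvPolynomial.eval₂_comp_left]
  congr 1
  funext p
  rcases p with p | p <;> simp

theorem RatOn.conj (h : RatOn R φ) : RatOn R (fun y => starRingEnd ℂ (φ y)) := by
  obtain ⟨q, d, h⟩ := h
  refine ⟨MvPolynomial.rename Sum.swap (MvPolynomial.map (starRingEnd ℂ) q),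
    MvPolynomial.rename Sum.swap (MvPolynomial.map (starRingEnd ℂ) d), fun y hy => ?_⟩
  rw [conjEval_swap, conjEval_swap, (h y hy).2, map_mul]
  exact ⟨(map_ne_zero _).2 (h y hy).1, rfl⟩

theorem RatOn.conjEval {T : (ι → ℂ) → (ι → ℂ)} (h : ∀ p, RatOn R (fun y => T y p))
    (f : MvPolynomial (ι ⊕ ι) ℂ) : RatOn R (fun y => conjEval (T y) f) := by
  induction f using MvPolynomial.induction_on with
  | C c => simpa [GossetElte.conjEval] using ratOn_const c
  | add f g hf hg => simpa using hf.add hg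
  | mul_X f p hf =>
    simp only [map_mul]
    refine hf.mul ?_
    rcases p with p | p
    · simpa [GossetElte.conjEval] using h p
    · simpa [GossetElte.conjEval] using (h p).conj

/-- One point where the function is nonzero shows that its numerator is a nonzero polynomial.
Generic conditions are thus reduced to examples. -/
theorem RatOn.big_ne_zero (h : RatOn R φ) (hR : Big R) {y : ι → ℂ} (hy : y ∈ R)
    (h0 : φ y ≠ 0) : Big {y | y ∈ R ∧ φ y ≠ 0} := by
  obtain ⟨q, d, h⟩ := h
  have hq : q ≠ 0 := by
    rintro rfl
    have := (h y hy).2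
    rw [map_zero, eq_comm, mul_eq_zero] at this
    exact this.elim h0 (h y hy).1
  refine (hR.inter ⟨q, hq, fun y hy => hy⟩ : Big (R ∩ {y | GossetElte.conjEval y q ≠ 0})).mono ?_
  rintro y ⟨hy, hy'⟩
  refine ⟨hy, fun h0 => hy' ?_⟩
  rw [(h y hy).2, h0, zero_mul]

theorem RatOn.big_ne_zero_of_univ (h : RatOn Set.univ φ) {y : ι → ℂ} (h0 : φ y ≠ 0) :
    Big {y | φ y ≠ 0} :=
  (h.big_ne_zero big_univ trivial h0).mono fun _ h => h.2

theorem ratOn_eval (f : MvPolynomial ι ℂ) : RatOn R (fun y => MvPolynomial.eval y f) :=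
  ⟨MvPolynomial.rename Sum.inl f, 1, fun y _ => by
    simp [GossetElte.conjEval, MvPolynomial.eval_rename, Sum.elim_comp_inl]⟩

theorem big_eval_ne_zero {f : MvPolynomial ι ℂ} (hf : f ≠ 0) :
    Big {y | MvPolynomial.eval y f ≠ 0} := by
  obtain ⟨y, hy⟩ : ∃ y, MvPolynomial.eval y f ≠ 0 := by
    by_contra! h
    exact hf (MvPolynomial.funext fun y => by simp [h])
  exact (ratOn_eval f).big_ne_zero_of_univ hy

end General

/-! ### Values of rational functions at a point. -/

section Values
variable {k i j : ℕ} {f g : RatField k i j} {y : Pos k i j → ℂ} {z w : ℂ}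

theorem algebraMap_ratField_injective : Function.Injective
    (algebraMap (MvPolynomial (Pos k i j) ℂ) (RatField k i j)) :=
  IsFractionRing.injective _ _

theorem algebraMap_ne_zero {q : MvPolynomial (Pos k i j) ℂ} (h : MvPolynomial.eval y q ≠ 0) :
    algebraMap _ (RatField k i j) q ≠ 0 := by
  rw [map_ne_zero_iff _ algebraMap_ratField_injective]
  rintro rfl
  simp at h

theorem hasValueAt_algebraMap (p : MvPolynomial (Pos k i j) ℂ) :
    HasValueAt (algebraMap _ (RatField k i j) p) y (MvPolynomial.eval y p) :=
  ⟨p, 1, by simp, by simp, by simp⟩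

theorem hasValueAt_var (p : Pos k i j) : HasValueAt (var p) y (y p) := by
  simpa [var] using hasValueAt_algebraMap (y := y) (MvPolynomial.X p)

theorem HasValueAt.unique (h : HasValueAt f y z) (h' : HasValueAt f y w) : z = w := by
  obtain ⟨p, q, hq, hf, rfl⟩ := h
  obtain ⟨p', q', hq', hf', rfl⟩ := h'
  rw [hf, div_eq_div_iff (algebraMap_ne_zero hq) (algebraMap_ne_zero hq'), ← map_mul, ← map_mul]
    at hf'
  rw [div_eq_div_iff hq hq', ← map_mul, ← map_mul, algebraMap_ratField_injective hf']

theorem HasValueAt.add (h : HasValueAt f y z) (h' : HasValueAt g y w) :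
    HasValueAt (f + g) y (z + w) := by
  obtain ⟨p, q, hq, rfl, rfl⟩ := h
  obtain ⟨p', q', hq', rfl, rfl⟩ := h'
  refine ⟨p * q' + q * p', q * q', by simp [hq, hq'], ?_, ?_⟩
  · rw [div_add_div _ _ (algebraMap_ne_zero hq) (algebraMap_ne_zero hq')]
    simp
  · rw [div_add_div _ _ hq hq']
    simp

theorem HasValueAt.mul (h : HasValueAt f y z) (h' : HasValueAt g y w) :
    HasValueAt (f * g) y (z * w) := by
  obtain ⟨p, q, hq, rfl, rfl⟩ := h
  obtain ⟨p', q', hq', rfl, rfl⟩ := h'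
  refine ⟨p * p', q * q', by simp [hq, hq'], ?_, ?_⟩
  · rw [div_mul_div_comm]
    simp
  · rw [div_mul_div_comm]
    simp

theorem HasValueAt.neg (h : HasValueAt f y z) : HasValueAt (-f) y (-z) := by
  simpa using (hasValueAt_algebraMap (y := y) (-1)).mul h

theorem HasValueAt.sub (h : HasValueAt f y z) (h' : HasValueAt g y w) :
    HasValueAt (f - g) y (z - w) := by
  simpa [sub_eq_add_neg] using h.add h'.neg

theorem HasValueAt.inv (h : HasValueAt f y z) (hz : z ≠ 0) : HasValueAt f⁻¹ y z⁻¹ := by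
  obtain ⟨p, q, hq, rfl, rfl⟩ := h
  exact ⟨q, p, (div_ne_zero_iff.1 hz).1, by simp, by simp⟩

theorem HasValueAt.div (h : HasValueAt f y z) (h' : HasValueAt g y w) (hw : w ≠ 0) :
    HasValueAt (f / g) y (z / w) := by
  simpa [div_eq_mul_inv] using h.mul (h'.inv hw)

theorem HasValueAt.ne_zero (h : HasValueAt f y z) (hz : z ≠ 0) : f ≠ 0 := by
  rintro rfl
  apply hz
  have := hasValueAt_algebraMap (y := y) (0 : MvPolynomial (Pos k i j) ℂ)
  rw [map_zero, map_zero] at this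
  exact h.unique this

theorem HasValueAt.sixthDen {A B C M D : RatField k i j} {a b c m d : ℂ}
    (hA : HasValueAt A y a) (hB : HasValueAt B y b) (hC : HasValueAt C y c)
    (hM : HasValueAt M y m) (hD : HasValueAt D y d) :
    HasValueAt (sixthDen A B C M D) y (sixthDen a b c m d) :=
  ((hA.sub hM).mul (hC.sub hD)).sub ((hA.sub hD).mul (hB.sub hM))

theorem HasValueAt.sixth {A B C M D : RatField k i j} {a b c m d : ℂ}
    (hA : HasValueAt A y a) (hB : HasValueAt B y b) (hC : HasValueAt C y c)
    (hM : HasValueAt M y m) (hD : HasValueAt D y d) (h : GossetElte.sixthDen a b c m d ≠ 0) :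
    HasValueAt (sixth A B C M D) y (sixth a b c m d) :=
  ((((hA.sub hM).mul (hC.sub hD)).mul hB).sub (((hA.sub hD).mul (hB.sub hM)).mul hC)).div
    (hA.sixthDen hB hC hM hD) h

/-- The entries of an array of rational functions are regular at `y`, with values `z`. -/
def ArrayValue (Y : Pos k i j → RatField k i j) (y z : Pos k i j → ℂ) : Prop :=
  ∀ p, HasValueAt (Y p) y (z p)

theorem arrayValue_var (y : Pos k i j → ℂ) : ArrayValue var y y := fun p => hasValueAt_var p

theorem ArrayValue.act {Y : Pos k i j → RatField k i j} {y z : Pos k i j → ℂ}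
    (h : ArrayValue Y y z) {a : Node k i j} (hz : a = .inl 0 → Reg z) :
    ArrayValue (act a Y) y (act a z) := by
  by_cases ha : a = .inl 0
  · subst ha
    simp only [act_zero]
    rintro (n | ⟨m, n⟩)
    · by_cases hn : n = 0
      · subst hn; simpa using h _
      · simpa only [actR0_inl _ hn] using h _
    · by_cases hm : m = 0 <;> by_cases hn : n = 0
      · subst hm hn; simpa using h _
      · subst hm; simpa only [actR0_zero_left _ hn] using h _
      · subst hn; simpa only [actR0_zero_right _ hm] using h _
      · rw [actR0_inr _ hm hn, actR0_inr _ hm hn]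
        exact (h _).sixth (h _) (h _) (h _) (h _) (hz rfl m n hm hn).2
  · intro p
    rw [act_apply ha, act_apply ha]
    exact h _

theorem Reg.of_arrayValue {Y : Pos k i j → RatField k i j} {y z : Pos k i j → ℂ}
    (h : ArrayValue Y y z) (hz : Reg z) : Reg Y := by
  intro m n hm hn
  obtain ⟨⟨h1, h2, h3, h4⟩, h5⟩ := hz m n hm hn
  have aux {p q : Pos k i j} (hpq : z p ≠ z q) : Y p ≠ Y q := fun e => hpq
    ((h p).unique (e ▸ h q))
  exact ⟨⟨aux h1, aux h2, aux h3, aux h4⟩,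
    ((h _).sixthDen (h _) (h _) (h _) (h _)).ne_zero h5⟩

theorem hasValueAt_aeval {Y : Pos k i j → RatField k i j} {y z : Pos k i j → ℂ}
    (h : ArrayValue Y y z) (g : MvPolynomial (Pos k i j) ℂ) :
    HasValueAt (MvPolynomial.aeval Y g) y (MvPolynomial.eval z g) := by
  induction g using MvPolynomial.induction_on with
  | C c => simpa [IsScalarTower.algebraMap_apply ℂ (MvPolynomial (Pos k i j) ℂ)] using
      hasValueAt_algebraMap (y := y) (MvPolynomial.C c)
  | add f g hf hg => simpa using hf.add hg
  | mul_X f p hf => simpa using hf.mul (h p)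

end Values

/-! ### Generic nondegeneracy of arrays. -/

section Generic
variable {k i j : ℕ}

theorem RatOn.sixthDen {ι : Type*} {R : Set (ι → ℂ)} {A B C M D : (ι → ℂ) → ℂ} (hA : RatOn R A)
    (hB : RatOn R B) (hC : RatOn R C) (hM : RatOn R M) (hD : RatOn R D) :
    RatOn R (fun y => sixthDen (A y) (B y) (C y) (M y) (D y)) :=
  ((hA.sub hM).mul (hC.sub hD)).sub ((hA.sub hD).mul (hB.sub hM))

theorem RatOn.sixth {ι : Type*} {R : Set (ι → ℂ)} {A B C M D : (ι → ℂ) → ℂ} (hA : RatOn R A)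
    (hB : RatOn R B) (hC : RatOn R C) (hM : RatOn R M) (hD : RatOn R D)
    (h : ∀ y ∈ R, GossetElte.sixthDen (A y) (B y) (C y) (M y) (D y) ≠ 0) :
    RatOn R (fun y => sixth (A y) (B y) (C y) (M y) (D y)) :=
  ((((hA.sub hM).mul (hC.sub hD)).mul hB).sub (((hA.sub hD).mul (hB.sub hM)).mul hC)).div
    (hA.sixthDen hB hC hM hD) h

theorem big_ne {ι : Type*} {p q : ι} (h : p ≠ q) : Big {y : ι → ℂ | y p ≠ y q} := by
  classical
  have : Big {y : ι → ℂ | y p - y q ≠ 0} :=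
    ((ratOn_apply p).sub (ratOn_apply q)).big_ne_zero_of_univ
      (y := fun x => if x = p then 1 else 0) (by simp [h.symm])
  simpa [sub_ne_zero] using this

theorem big_reg : Big {y : Pos k i j → ℂ | Reg y} := by
  refine Big.iInter fun m => Big.iInter fun n => ?_
  by_cases hm : m = 0
  · exact big_univ.mono fun y _ h => absurd hm h
  by_cases hn : n = 0
  · exact big_univ.mono fun y _ _ h => absurd hn h
  have h5 : Big {y : Pos k i j → ℂ | sixthDen (y (.inl 0)) (y (.inr (0, n))) (y (.inr (0, 0)))
      (y (.inr (m, n))) (y (.inr (m, 0))) ≠ 0} := by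
    -- At the chosen point `A = C = M = 0` and `B = D = 1`, so the denominator equals `1`.
    refine ((ratOn_apply _).sixthDen (ratOn_apply _) (ratOn_apply _) (ratOn_apply _)
      (ratOn_apply _)).big_ne_zero_of_univ (y := fun p => if p = .inr (0, n) ∨ p = .inr (m, 0)
        then 1 else 0) ?_
    simp [sixthDen, hm, hn, Ne.symm hm, Ne.symm hn]
  refine ((((big_ne (p := .inl 0) (q := .inr (0, n)) (by simp)).inter
    (big_ne (p := .inl 0) (q := .inr (m, 0)) (by simp))).inter
    ((big_ne (p := .inr (0, 0)) (q := .inr (0, n)) (by simp [Ne.symm hn])).inter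
    (big_ne (p := .inr (0, 0)) (q := .inr (m, 0)) (by simp [Ne.symm hm])))).inter h5).mono ?_
  rintro y ⟨⟨⟨h1, h2⟩, h3, h4⟩, h5⟩ _ _
  exact ⟨⟨h1, h2, h3, h4⟩, h5⟩

theorem Reg.act_self {a : Node k i j} {y : Pos k i j → ℂ} (h : Reg y) : act a (act a y) = y :=
  act_act_self fun _ => h

theorem ratOn_act (a : Node k i j) (p : Pos k i j) :
    RatOn {y : Pos k i j → ℂ | a = .inl 0 → Reg y} (fun y => act a y p) := by
  by_cases ha : a = .inl 0
  · subst ha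
    simp only [act_zero]
    rcases p with n | ⟨m, n⟩
    · by_cases hn : n = 0
      · subst hn; simpa using ratOn_apply _
      · simpa only [actR0_inl _ hn] using ratOn_apply _
    · by_cases hm : m = 0 <;> by_cases hn : n = 0
      · subst hm hn; simpa using ratOn_apply _
      · subst hm; simpa only [actR0_zero_left _ hn] using ratOn_apply _
      · subst hn; simpa only [actR0_zero_right _ hm] using ratOn_apply _
      · simp only [actR0_inr _ hm hn]
        exact (ratOn_apply _).sixth (ratOn_apply _) (ratOn_apply _) (ratOn_apply _)
          (ratOn_apply _) fun y hy => (hy trivial m n hm hn).2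
  · simp only [act_apply ha]
    exact ratOn_apply _

/-- Preimages of big sets under the action of a generator are big. -/
theorem Big.preimage_act {U : Set (Pos k i j → ℂ)} (hU : Big U) (a : Node k i j) :
    Big {y | (a = .inl 0 → Reg y) ∧ act a y ∈ U} := by
  obtain ⟨f, hf, h⟩ := hU
  obtain ⟨y, hy, hy'⟩ := (big_reg.inter ⟨f, hf, fun y hy => hy⟩ :
    Big ({y : Pos k i j → ℂ | Reg y} ∩ {y | conjEval y f ≠ 0})).nonempty
  have h1 : a = .inl 0 → Reg (act a y) := by rintro rfl; exact hy.actR0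
  have h2 : act a (act a y) = y := hy.act_self
  -- The generator is an involution on nondegenerate arrays, so the image of a good point `y` is
  -- mapped back to `y`, where `f` does not vanish.
  refine ((RatOn.conjEval (ratOn_act a) f).big_ne_zero
    (big_reg.mono fun y hy _ => hy) (y := act a y) h1 ?_).mono
    fun y hy => ⟨hy.1, h _ hy.2⟩
  rw [h2]
  exact hy'

theorem reg_var : Reg (var : Pos k i j → RatField k i j) := by
  obtain ⟨y, hy⟩ := (big_reg (k := k) (i := i) (j := j)).nonempty
  exact hy.of_arrayValue (arrayValue_var y)

theorem eq_zero_of_big {U : Set (Pos k i j → ℂ)} (hU : Big U) {g : MvPolynomial (Pos k i j) ℂ}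
    (h : ∀ y ∈ U, MvPolynomial.eval y g = 0) : g = 0 := by
  by_contra hg
  obtain ⟨y, hy, hy'⟩ := (hU.inter (big_eval_ne_zero hg)).nonempty
  exact hy' (h y hy)

end Generic

/-! ### Field automorphisms given by the generators. -/

section Automorphisms
variable {k i j : ℕ}

theorem map_sixth {F F' : Type*} [Field F] [Field F'] (f : F →+* F') (A B C M D : F) :
    f (sixth A B C M D) = sixth (f A) (f B) (f C) (f M) (f D) := by
  simp [sixth]

theorem map_sixthDen {F F' : Type*} [Field F] [Field F'] (f : F →+* F') (A B C M D : F) :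
    f (sixthDen A B C M D) = sixthDen (f A) (f B) (f C) (f M) (f D) := by
  simp [sixthDen]

theorem map_act {F F' : Type*} [Field F] [Field F'] (f : F →+* F') (a : Node k i j)
    (y : Pos k i j → F) (p : Pos k i j) : f (act a y p) = act a (fun q => f (y q)) p := by
  by_cases ha : a = .inl 0
  · subst ha
    simp only [act_zero]
    rcases p with n | ⟨m, n⟩
    · by_cases hn : n = 0
      · subst hn; simp
      · simp only [actR0_inl _ hn]
    · by_cases hm : m = 0 <;> by_cases hn : n = 0
      · subst hm hn; simp
      · subst hm; simp only [actR0_zero_left _ hn]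
      · subst hn; simp only [actR0_zero_right _ hm]
      · simp only [actR0_inr _ hm hn, map_sixth]
  · simp only [act_apply ha]

theorem Reg.map {F F' : Type*} [Field F] [Field F'] (f : F →+* F') {y : Pos k i j → F}
    (h : Reg y) : Reg (fun q => f (y q)) := by
  intro m n hm hn
  obtain ⟨⟨h1, h2, h3, h4⟩, h5⟩ := h m n hm hn
  refine ⟨⟨f.injective.ne h1, f.injective.ne h2, f.injective.ne h3, f.injective.ne h4⟩, ?_⟩
  rw [← map_sixthDen]
  exact (map_ne_zero f).2 h5

/-- If a polynomial `g` vanishes on the transformed variables, evaluation at `act a y` gives `g(y) =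
0` for generic `y`, by involutivity. -/
theorem aeval_act_var_injective (a : Node k i j) :
    Function.Injective (MvPolynomial.aeval (act a (var : Pos k i j → RatField k i j)) :
      MvPolynomial (Pos k i j) ℂ →ₐ[ℂ] RatField k i j) := by
  rw [injective_iff_map_eq_zero]
  intro g hg
  refine eq_zero_of_big (big_reg.inter (big_reg.preimage_act a)) fun y hy => ?_
  have hy' : a = .inl 0 → Reg (act a y) := fun _ => hy.2.2
  have h := hasValueAt_aeval ((arrayValue_var (act a y)).act (a := a) hy') g
  rw [hg, hy.1.act_self] at h
  by_contra h0
  exact h.ne_zero h0 rfl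

/-- The endomorphism of the field of rational functions given by a generator. -/
noncomputable def nodeAlgHom (a : Node k i j) : RatField k i j →ₐ[ℂ] RatField k i j :=
  IsFractionRing.liftAlgHom (aeval_act_var_injective a)

theorem nodeAlgHom_var (a : Node k i j) (p : Pos k i j) :
    nodeAlgHom a (var p) = act a var p := by
  rw [nodeAlgHom, IsFractionRing.liftAlgHom_apply, var, IsFractionRing.lift_algebraMap]
  simp

theorem algHom_ext_var {f g : RatField k i j →ₐ[ℂ] RatField k i j}
    (h : ∀ p, f (var p) = g (var p)) : f = g := by
  have h1 : (f.comp (IsScalarTower.toAlgHom ℂ (MvPolynomial (Pos k i j) ℂ) (RatField k i j))) =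
      g.comp (IsScalarTower.toAlgHom ℂ (MvPolynomial (Pos k i j) ℂ) (RatField k i j)) :=
    MvPolynomial.algHom_ext fun p => h p
  have h2 : (f : RatField k i j →+* RatField k i j) = g :=
    IsFractionRing.ringHom_ext (A := MvPolynomial (Pos k i j) ℂ) fun x => AlgHom.congr_fun h1 x
  exact AlgHom.ext fun x => RingHom.congr_fun h2 x

theorem nodeAlgHom_comp_self (a : Node k i j) :
    (nodeAlgHom a).comp (nodeAlgHom a) = AlgHom.id ℂ (RatField k i j) := by
  refine algHom_ext_var fun p => ?_
  rw [AlgHom.comp_apply, nodeAlgHom_var]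
  refine (map_act (nodeAlgHom a : RatField k i j →+* RatField k i j) a var p).trans ?_
  simp only [RingHom.coe_coe, nodeAlgHom_var]
  exact congrFun (act_act_self fun _ => reg_var) p

/-- The automorphism of the field of rational functions given by a generator. -/
noncomputable def nodeAlgEquiv (a : Node k i j) : RatField k i j ≃ₐ[ℂ] RatField k i j :=
  AlgEquiv.ofAlgHom (nodeAlgHom a) (nodeAlgHom a) (nodeAlgHom_comp_self a)
    (nodeAlgHom_comp_self a)

theorem nodeAlgEquiv_var (a : Node k i j) (p : Pos k i j) :
    nodeAlgEquiv a (var p) = act a var p := nodeAlgHom_var a p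

theorem algEquiv_apply_act (f : RatField k i j ≃ₐ[ℂ] RatField k i j) (a : Node k i j)
    (Y : Pos k i j → RatField k i j) (p : Pos k i j) :
    f (act a Y p) = act a (fun q => f (Y q)) p :=
  map_act (f : RatField k i j →+* RatField k i j) a Y p

/-- Automorphisms commute with the rational formulas of `act`. Hence right multiplication by a
generator acts on the array of images, and the letters of a word act from left to right. -/
theorem algEquiv_mul_nodeAlgEquiv_var (f : RatField k i j ≃ₐ[ℂ] RatField k i j) (a : Node k i j) :
    (fun p => (f * nodeAlgEquiv a) (var p)) = act a (fun p => f (var p)) := by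
  funext p
  rw [AlgEquiv.mul_apply, nodeAlgEquiv_var, algEquiv_apply_act]

theorem algEquiv_ext_var {f g : RatField k i j ≃ₐ[ℂ] RatField k i j}
    (h : (fun p => f (var p)) = fun p => g (var p)) : f = g := by
  have := algHom_ext_var (f := (f : RatField k i j →ₐ[ℂ] RatField k i j)) (g := g)
    fun p => congrFun h p
  exact AlgEquiv.ext fun x => AlgHom.congr_fun this x

theorem reg_algEquiv_var (f : RatField k i j ≃ₐ[ℂ] RatField k i j) :
    Reg (fun p => f (var p)) :=
  reg_var.map (f : RatField k i j →+* RatField k i j)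

theorem nodeAlgEquiv_mul_self (a : Node k i j) : nodeAlgEquiv a * nodeAlgEquiv a = 1 := by
  apply algEquiv_ext_var
  rw [algEquiv_mul_nodeAlgEquiv_var]
  simp only [nodeAlgEquiv_var]
  exact act_act_self fun _ => reg_var

theorem act_act_var (a b : Node k i j) :
    act b (act a var) = fun p => (nodeAlgEquiv a * nodeAlgEquiv b) (var p) := by
  rw [algEquiv_mul_nodeAlgEquiv_var]
  simp only [nodeAlgEquiv_var]

theorem nodeAlgEquiv_braid {a b : Node k i j} (h : Link a b) :
    nodeAlgEquiv a * nodeAlgEquiv b * nodeAlgEquiv a =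
      nodeAlgEquiv b * nodeAlgEquiv a * nodeAlgEquiv b := by
  apply algEquiv_ext_var
  rw [algEquiv_mul_nodeAlgEquiv_var, algEquiv_mul_nodeAlgEquiv_var (nodeAlgEquiv b * _),
    ← act_act_var, ← act_act_var]
  refine act_braid h fun _ => ⟨reg_var, ?_, ?_⟩
  · simpa only [nodeAlgEquiv_var] using reg_algEquiv_var (nodeAlgEquiv b)
  · rw [act_act_var]
    exact reg_algEquiv_var _

theorem nodeAlgEquiv_commute {a b : Node k i j} (hab : a ≠ b) (h : ¬ Link a b)
    (h' : ¬ Link b a) : nodeAlgEquiv a * nodeAlgEquiv b = nodeAlgEquiv b * nodeAlgEquiv a := by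
  apply algEquiv_ext_var
  rw [← act_act_var, ← act_act_var]
  exact (act_commute hab h h' _).symm

end Automorphisms

/-! ### The action of the Coxeter group. -/

section Lift
variable {k i j : ℕ}

theorem coxeterMatrix_of_link {a b : Node k i j} (hab : a ≠ b) (h : Link a b ∨ Link b a) :
    (coxeterMatrix k i j) a b = 3 := by
  simp [coxeterMatrix, hab, h]

theorem coxeterMatrix_of_not_link {a b : Node k i j} (hab : a ≠ b) (h : ¬ (Link a b ∨ Link b a)) :
    (coxeterMatrix k i j) a b = 2 := by
  simp [coxeterMatrix, hab, h]

/-- Involutions satisfying the braid relations of the graph satisfy the relations of its Coxeter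
group. -/
theorem isLiftable_of_braid {G : Type*} [Group G] {f : Node k i j → G}
    (h1 : ∀ a, f a * f a = 1)
    (h2 : ∀ a b, a ≠ b → ¬ Link a b → ¬ Link b a → f a * f b = f b * f a)
    (h3 : ∀ a b, Link a b → f a * f b * f a = f b * f a * f b) :
    (coxeterMatrix k i j).IsLiftable f := by
  intro a b
  by_cases hab : a = b
  · subst hab
    rw [h1, one_pow]
  by_cases h : Link a b ∨ Link b a
  · rw [coxeterMatrix_of_link hab h]
    have key : f a * f b * f a = f b * f a * f b := by
      rcases h with h | h
      · exact h3 a b h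
      · exact (h3 b a h).symm
    calc (f a * f b) ^ 3 = (f a * f b * f a) * (f b * f a * f b) := by
          simp only [pow_succ, pow_zero, one_mul, mul_assoc]
      _ = (f b * f a * f b) * (f b * f a * f b) := by rw [key]
      _ = f b * f a * (f b * f b) * f a * f b := by group
      _ = f b * (f a * f a) * f b := by rw [h1 b]; group
      _ = 1 := by rw [h1 a, mul_one, h1 b]
  · rw [coxeterMatrix_of_not_link hab h, pow_two]
    push Not at h
    calc f a * f b * (f a * f b) = f b * f a * (f a * f b) := by rw [h2 a b hab h.1 h.2]
      _ = f b * (f a * f a) * f b := by group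
      _ = 1 := by rw [h1 a, mul_one, h1 b]

/-- The birational action of the Coxeter group. -/
noncomputable def birationalAction (k i j : ℕ) :
    W k i j →* (RatField k i j ≃ₐ[ℂ] RatField k i j) :=
  (coxeterMatrix k i j).toCoxeterSystem.lift ⟨nodeAlgEquiv, isLiftable_of_braid
    nodeAlgEquiv_mul_self (fun _ _ => nodeAlgEquiv_commute) fun _ _ => nodeAlgEquiv_braid⟩

theorem birationalAction_gen (a : Node k i j) :
    birationalAction k i j (gen a) = nodeAlgEquiv a := by
  have := (coxeterMatrix k i j).toCoxeterSystem.lift_apply_simple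
    (isLiftable_of_braid (k := k) (i := i) (j := j)
    nodeAlgEquiv_mul_self (fun _ _ => nodeAlgEquiv_commute) fun _ _ => nodeAlgEquiv_braid) a
  rwa [CoxeterMatrix.toCoxeterSystem_simple] at this

theorem birationalAction_gen_var (a : Node k i j) (p : Pos k i j) :
    birationalAction k i j (gen a) (var p) = act a var p := by
  rw [birationalAction_gen, nodeAlgEquiv_var]

theorem birationalAction_mul_gen_var (w : W k i j) (a : Node k i j) :
    (fun p => birationalAction k i j (w * gen a) (var p)) =
      act a (fun p => birationalAction k i j w (var p)) := by
  rw [map_mul, birationalAction_gen, algEquiv_mul_nodeAlgEquiv_var]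

theorem gen_mul_self (a : Node k i j) : (gen a : W k i j) * gen a = 1 := by
  have := (coxeterMatrix k i j).toCoxeterSystem.simple_mul_simple_self a
  rwa [CoxeterMatrix.toCoxeterSystem_simple] at this

theorem mul_gen_gen (w : W k i j) (a : Node k i j) : w * gen a * gen a = w := by
  rw [mul_assoc, gen_mul_self, mul_one]

theorem gen_commute {a b : Node k i j} (hab : a ≠ b) (h : ¬ Link a b)
    (h' : ¬ Link b a) : (gen a : W k i j) * gen b = gen b * gen a := by
  have := (coxeterMatrix k i j).toCoxeterSystem.simple_mul_simple_pow a b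
  rw [CoxeterMatrix.toCoxeterSystem_simple] at this
  rw [coxeterMatrix_of_not_link hab (by tauto), pow_two] at this
  change gen a * gen b * (gen a * gen b) = 1 at this
  calc gen a * gen b = gen a * gen b * (gen a * gen b * (gen b * gen a)) := by
        rw [mul_assoc (gen a) (gen b) (gen b * gen a), ← mul_assoc (gen b) (gen b),
          gen_mul_self, one_mul, gen_mul_self, mul_one]
    _ = gen b * gen a := by rw [← mul_assoc, this, one_mul]

theorem gen_braid {a b : Node k i j} (hab : a ≠ b) (h : Link a b ∨ Link b a) :
    (gen a : W k i j) * gen b * gen a = gen b * gen a * gen b := by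
  have := (coxeterMatrix k i j).toCoxeterSystem.simple_mul_simple_pow a b
  rw [CoxeterMatrix.toCoxeterSystem_simple] at this
  rw [coxeterMatrix_of_link hab h] at this
  change (gen a * gen b) ^ 3 = 1 at this
  have e (c : Node k i j) : (gen c : W k i j)⁻¹ = gen c := inv_eq_of_mul_eq_one_left (gen_mul_self c)
  have h2 : (gen a * gen b * gen a) * (gen b * gen a * gen b) = (1 : W k i j) := by
    rw [← this]
    simp only [pow_succ, pow_zero, one_mul, mul_assoc]
  have h3 := eq_inv_of_mul_eq_one_left h2
  rw [h3]
  simp [e, mul_assoc]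

theorem gen_induction {P : W k i j → Prop} (w : W k i j) (one : P 1)
    (mul_gen : ∀ (w : W k i j) (a : Node k i j), P w → P (w * gen a)) : P w := by
  refine (coxeterMatrix k i j).toCoxeterSystem.simple_induction_right w one fun w a h => ?_
  rw [CoxeterMatrix.toCoxeterSystem_simple]
  exact mul_gen w a h

end Lift

/-! ### Root positivity and the stabiliser of a weight. -/

section Roots
variable {k i j : ℕ}

open Classical in
/-- The coefficients of the dual geometric representation, extended by the index `none`
for the fundamental weight of `r_k`. -/
noncomputable def rootCoeff (a : Node k i j) : Option (Node k i j) → ℝ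
  | none => if a = .inl (Fin.last k) then 1 else 0
  | some b => if a = b then -2 else if Link a b ∨ Link b a then 1 else 0

/-- The action of a generator in the dual geometric representation. -/
noncomputable def rootAct (a : Node k i j) (v : Option (Node k i j) → ℝ) :
    Option (Node k i j) → ℝ :=
  fun c => v c + rootCoeff a c * v (some a)

theorem rootCoeff_self (a : Node k i j) : rootCoeff a (some a) = -2 := by simp [rootCoeff]

theorem rootCoeff_of_link {a b : Node k i j} (hab : a ≠ b) (h : Link a b ∨ Link b a) :
    rootCoeff a (some b) = 1 := by
  simp [rootCoeff, hab, h]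

theorem rootCoeff_of_not_link {a b : Node k i j} (hab : a ≠ b) (h : ¬ (Link a b ∨ Link b a)) :
    rootCoeff a (some b) = 0 := by
  simp [rootCoeff, hab, h]

theorem Link.ne {a b : Node k i j} (h : Link a b) : a ≠ b := by
  rintro rfl
  rcases a with a | a | a <;> simp [Link] at h

theorem rootAct_rootAct_self (a : Node k i j) : Function.Involutive (rootAct a) := by
  intro v
  funext c
  simp only [rootAct, rootCoeff_self]
  ring

/-- The action of a generator in the dual geometric representation, as a permutation. -/
noncomputable def rootPerm (a : Node k i j) : Equiv.Perm (Option (Node k i j) → ℝ) :=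
  (rootAct_rootAct_self a).toPerm

theorem rootPerm_apply (a : Node k i j) (v : Option (Node k i j) → ℝ) :
    rootPerm a v = rootAct a v := rfl

theorem isLiftable_rootPerm :
    (coxeterMatrix k i j).IsLiftable (rootPerm (k := k) (i := i) (j := j)) := by
  refine isLiftable_of_braid (fun a => ?_) (fun a b hab h h' => ?_) fun a b h => ?_
  · ext v : 1
    exact rootAct_rootAct_self a v
  · ext v : 1
    funext c
    have h1 := rootCoeff_of_not_link hab (by tauto)
    have h2 := rootCoeff_of_not_link hab.symm (by tauto)
    simp only [Equiv.Perm.mul_apply, rootPerm_apply, rootAct, h1, h2]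
    ring
  · ext v : 1
    funext c
    have h1 := rootCoeff_of_link h.ne (.inl h)
    have h2 := rootCoeff_of_link h.ne.symm (.inr h)
    simp only [Equiv.Perm.mul_apply, rootPerm_apply, rootAct, h1, h2, rootCoeff_self]
    ring

/-- The dual geometric representation. -/
noncomputable def rootHom (k i j : ℕ) : W k i j →* Equiv.Perm (Option (Node k i j) → ℝ) :=
  (coxeterMatrix k i j).toCoxeterSystem.lift ⟨rootPerm, isLiftable_rootPerm⟩

/-- The values of the simple roots, and of the fundamental weight of `r_k`, at the images of a
point of the fundamental chamber. -/
noncomputable def rootValue (w : W k i j) : Option (Node k i j) → ℝ :=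
  rootHom k i j w⁻¹ (fun c => if c = none then 0 else 1)

theorem rootValue_one (c : Option (Node k i j)) :
    rootValue (1 : W k i j) c = if c = none then 0 else 1 := by
  simp [rootValue]

theorem rootValue_mul_gen (w : W k i j) (a : Node k i j) :
    rootValue (w * gen a) = rootAct a (rootValue w) := by
  have e : (gen a : W k i j)⁻¹ = gen a := inv_eq_of_mul_eq_one_left (gen_mul_self a)
  have h := (coxeterMatrix k i j).toCoxeterSystem.lift_apply_simple
    (isLiftable_rootPerm (k := k) (i := i) (j := j)) a
  rw [CoxeterMatrix.toCoxeterSystem_simple] at h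
  rw [rootValue, mul_inv_rev, e, map_mul, Equiv.Perm.mul_apply]
  exact DFunLike.congr_fun h _

/-- The length of an element of the Coxeter group. -/
noncomputable def len (w : W k i j) : ℕ := (coxeterMatrix k i j).toCoxeterSystem.length w

theorem len_mul_gen (w : W k i j) (a : Node k i j) :
    len (w * gen a) = len w + 1 ∨ len (w * gen a) + 1 = len w := by
  have := (coxeterMatrix k i j).toCoxeterSystem.length_mul_simple w a
  rwa [CoxeterMatrix.toCoxeterSystem_simple] at this

theorem exists_eq_mul_gen {w : W k i j} (hw : w ≠ 1) :
    ∃ (w' : W k i j) (a : Node k i j), w = w' * gen a ∧ len w = len w' + 1 := by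
  obtain ⟨a, ha⟩ := (coxeterMatrix k i j).toCoxeterSystem.exists_rightDescent_of_ne_one hw
  rw [CoxeterSystem.isRightDescent_iff, CoxeterMatrix.toCoxeterSystem_simple] at ha
  exact ⟨w * gen a, a, (mul_gen_gen w a).symm, ha.symm⟩

/-- The classical fact that a simple root is sent to a positive root when the length goes up, by
induction on length inside the rank two subgroup of `a` and the last letter `b`. -/
theorem rootValue_pos (w : W k i j) (a : Node k i j) (h : len w < len (w * gen a)) :
    0 < rootValue w (some a) := by
  induction hN : len w using Nat.strong_induction_on generalizing w a with
  | _ N ih =>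
  subst hN
  by_cases hw : w = 1
  · subst hw
    simp [rootValue_one]
  obtain ⟨w', b, rfl, hb⟩ := exists_eq_mul_gen hw
  have hab : b ≠ a := by
    rintro rfl
    rw [mul_gen_gen] at h
    omega
  have hb1 : len w' < len (w' * gen b) := by omega
  rw [rootValue_mul_gen, rootAct]
  by_cases hl : Link b a ∨ Link a b
  · rw [rootCoeff_of_link hab hl]
    have pb := ih (len w') hb1 w' b hb1 rfl
    rcases len_mul_gen w' a with ha | ha
    · have pa := ih (len w') hb1 w' a (by omega) rfl
      linarith
    -- Here `w = uab`, and the value of `a` at `w` is that of `b` at `u`. If `ub` were shorter than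
    -- `u`, then `uaba = ubab` would have length at most `len u + 1`, whereas its length is `len u +
    -- 3`.
    · obtain ⟨u, hu⟩ : ∃ u, u = w' * gen a := ⟨_, rfl⟩
      have hw' : w' = u * gen a := by rw [hu, mul_gen_gen]
      rw [← hu] at ha
      subst hw'
      have e : u * gen a * gen b * gen a = u * gen b * gen a * gen b := by
        have := gen_braid hab.symm hl.symm
        simp only [mul_assoc] at this ⊢
        rw [this]
      rw [e] at h
      have hub : len u < len (u * gen b) := by
        rcases len_mul_gen u b with hh | hh
        · omega
        · have h1 := len_mul_gen (u * gen b) a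
          have h2 := len_mul_gen (u * gen b * gen a) b
          omega
      have pu := ih (len u) (by omega) u b hub rfl
      rw [rootValue_mul_gen, rootAct, rootAct, rootCoeff_self, rootCoeff_of_link hab.symm hl.symm]
      linarith
  · rw [rootCoeff_of_not_link hab hl]
    have hl' : ¬ Link b a ∧ ¬ Link a b := by tauto
    have hwa : len w' < len (w' * gen a) := by
      rcases len_mul_gen w' a with hh | hh
      · omega
      · have h1 := len_mul_gen (w' * gen a) b
        rw [mul_assoc, gen_commute hab hl'.1 hl'.2, ← mul_assoc] at h
        omega
    have pa := ih (len w') hb1 w' a hwa rfl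
    linarith

theorem rootValue_ne_zero (w : W k i j) (a : Node k i j) : rootValue w (some a) ≠ 0 := by
  rcases len_mul_gen w a with h | h
  · exact (rootValue_pos w a (by omega)).ne'
  · have := rootValue_pos (w * gen a) a (by rw [mul_gen_gen]; omega)
    rw [rootValue_mul_gen, rootAct, rootCoeff_self] at this
    intro h0
    rw [h0] at this
    simp at this

/-- Along a reduced word this coordinate changes only at the letters `r_k`, each time by a positive
amount. It stays zero only if no such letter occurs. -/
theorem rootValue_none (w : W k i j) :
    0 ≤ rootValue w none ∧ (rootValue w none = 0 → w ∈ vertexStabilizer k i j) := by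
  induction hN : len w using Nat.strong_induction_on generalizing w with
  | _ N ih =>
  subst hN
  by_cases hw : w = 1
  · subst hw
    simp [rootValue_one, one_mem]
  obtain ⟨w', b, rfl, hb⟩ := exists_eq_mul_gen hw
  obtain ⟨h1, h2⟩ := ih (len w') (by omega) w' rfl
  have hp := rootValue_pos w' b (by omega)
  rw [rootValue_mul_gen, rootAct]
  by_cases hbk : b = .inl (Fin.last k)
  · simp only [rootCoeff, hbk, if_true]
    rw [hbk] at hp
    exact ⟨by linarith, fun h => by linarith⟩
  · simp only [rootCoeff, hbk, if_false, zero_mul, add_zero]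
    exact ⟨h1, fun h => mul_mem (h2 h) (Subgroup.subset_closure ⟨b, hbk, rfl⟩)⟩

end Roots

/-! ### Arrays on which the action of `r_0` is linear. -/

section AffineArrays
variable {k i j : ℕ}

/-- Arrays with `y_{mn} = y_{m0} + y_{0n} - y_{00}` with given differences of adjacent entries. -/
structure IsAffineArray (z : Pos k i j → ℂ) (v : Option (Node k i j) → ℝ) : Prop where
  last : z (.inl (Fin.last k)) = v none
  head (n : Fin k) : z (.inl n.castSucc) - z (.inl n.succ) = v (some (.inl n.succ))
  zero : z (.inr (0, 0)) - z (.inl 0) = v (some (.inl 0))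
  col (m : Fin i) (n : Fin (j + 1)) :
    z (.inr (m.succ, n)) - z (.inr (m.castSucc, n)) = v (some (.inr (.inl m)))
  row (m : Fin (i + 1)) (n : Fin j) :
    z (.inr (m, n.succ)) - z (.inr (m, n.castSucc)) = v (some (.inr (.inr n)))

theorem IsAffineArray.apply {z : Pos k i j → ℂ} {v : Option (Node k i j) → ℝ}
    (h : IsAffineArray z v) (m : Fin (i + 1)) (n : Fin (j + 1)) :
    z (.inr (m, n)) = z (.inr (m, 0)) + z (.inr (0, n)) - z (.inr (0, 0)) := by
  induction m using Fin.induction with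
  | zero => ring
  | succ m ih =>
    linear_combination ih + h.col m n - h.col m 0

/-- The coefficients of the dual geometric representation of a path. -/
noncomputable def pathCoeff {N : ℕ} (m n : Fin N) : ℝ :=
  if m = n then -2 else if m.val + 1 = n.val ∨ n.val + 1 = m.val then 1 else 0

/-- Adjacent differences are the simple roots of type `A`, transformed by a simple reflection. -/
theorem sub_swap_adjacent {N : ℕ} {g : Fin (N + 1) → ℂ} {u : Fin N → ℂ}
    (h : ∀ n, g n.succ - g n.castSucc = u n) (m n : Fin N) :
    g (Equiv.swap m.castSucc m.succ n.succ) - g (Equiv.swap m.castSucc m.succ n.castSucc) =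
      u n + pathCoeff m n * u m := by
  unfold pathCoeff
  by_cases hmn : m = n
  · subst hmn
    simp only [Equiv.swap_apply_right, Equiv.swap_apply_left, if_true]
    push_cast
    linear_combination -h m
  have hne : m.val ≠ n.val := fun h => hmn (Fin.ext h)
  rw [if_neg hmn]
  by_cases h1 : m.val + 1 = n.val
  · have e : m.succ = n.castSucc := by ext; simp [h1]
    rw [if_pos (.inl h1), ← h m, ← h n, e, Equiv.swap_apply_right,
      Equiv.swap_apply_of_ne_of_ne (by simp [Fin.ext_iff]; omega) (by simp [Fin.ext_iff])]
    push_cast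
    ring
  by_cases h2 : n.val + 1 = m.val
  · have e : n.succ = m.castSucc := by ext; simp [h2]
    rw [if_pos (.inr h2), ← h m, ← h n, e, Equiv.swap_apply_left,
      Equiv.swap_apply_of_ne_of_ne (by simp [Fin.ext_iff]; omega) (by simp [Fin.ext_iff]; omega)]
    push_cast
    ring
  · rw [if_neg (by tauto), ← h n,
      Equiv.swap_apply_of_ne_of_ne (by simp [Fin.ext_iff]; omega) (by simp [Fin.ext_iff]; omega),
      Equiv.swap_apply_of_ne_of_ne (by simp [Fin.ext_iff]; omega) (by simp [Fin.ext_iff]; omega)]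
    push_cast
    ring

/-- When `y_{mn} = y_{m0} + y_{0n} - y_{00}`, the multi-ratio equation is solved by `y_{m0} + y_{0n}
- y_0`. This has the same shape with `y_0` and `y_{00}` exchanged, so differences transform
linearly. -/
theorem IsAffineArray.actR0 {z : Pos k i j → ℂ} {v : Option (Node k i j) → ℝ}
    (h : IsAffineArray z v) (hz : Reg z) : IsAffineArray (actR0 z) (rootAct (.inl 0) v) := by
  have key (m : Fin (i + 1)) (n : Fin (j + 1)) (hm : m ≠ 0) (hn : n ≠ 0) :
      GossetElte.actR0 z (.inr (m, n)) = z (.inr (m, 0)) + z (.inr (0, n)) - z (.inl 0) := by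
    rw [actR0_inr _ hm hn]
    symm
    rw [eq_sixth_iff (hz m n hm hn).2, h.apply m n]
    unfold quadPoly
    ring
  have hz0 := h.zero
  constructor
  · by_cases hk : Fin.last k = 0
    · have hl := h.last
      rw [hk] at hl ⊢
      simp only [rootAct, rootCoeff, hk, actR0_inl_zero, if_true]
      push_cast
      linear_combination hz0 + hl
    · rw [actR0_inl _ hk]
      simp [rootAct, rootCoeff, Ne.symm hk, h.last]
  · intro n
    rw [actR0_inl _ (Fin.succ_ne_zero n)]
    by_cases hn : n.castSucc = 0
    · have hn0 : n.val = 0 := by simpa [Fin.ext_iff] using hn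
      have := h.head n
      rw [hn] at this ⊢
      simp only [rootAct, actR0_inl_zero]
      rw [rootCoeff_of_link (by simp [(Fin.succ_ne_zero n).symm]) (.inl (by simp [Link, hn0]))]
      push_cast
      linear_combination this + hz0
    · have hn0 : n.val ≠ 0 := by simpa [Fin.ext_iff] using hn
      rw [actR0_inl _ hn, h.head, rootAct, rootCoeff_of_not_link
        (by simp [(Fin.succ_ne_zero n).symm]) (by simp [Link, hn0])]
      simp
  · simp only [actR0_zero_zero, actR0_inl_zero, rootAct, rootCoeff_self]
    push_cast
    linear_combination -hz0
  · intro m n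
    have h1 := h.col m n
    have h2 := h.col m 0
    by_cases hm : m.castSucc = 0
    · have hm0 : m.val = 0 := by simpa [Fin.ext_iff] using hm
      rw [rootAct, rootCoeff_of_link (by simp) (.inl (by simp [Link, hm0]))]
      push_cast
      rw [hm] at h1 h2 ⊢
      by_cases hn : n = 0
      · subst hn
        rw [actR0_zero_right _ (Fin.succ_ne_zero m), actR0_zero_zero]
        linear_combination h1 + hz0
      · rw [key _ _ (Fin.succ_ne_zero m) hn, actR0_zero_left _ hn]
        linear_combination h2 + hz0
    · have hm0 : m.val ≠ 0 := by simpa [Fin.ext_iff] using hm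
      rw [rootAct, rootCoeff_of_not_link (by simp) (by simp [Link, hm0])]
      push_cast
      by_cases hn : n = 0
      · subst hn
        rw [actR0_zero_right _ (Fin.succ_ne_zero m), actR0_zero_right _ hm]
        linear_combination h1
      · rw [key _ _ (Fin.succ_ne_zero m) hn, key _ _ hm hn]
        linear_combination h2
  · intro m n
    have h1 := h.row m n
    have h2 := h.row 0 n
    by_cases hn : n.castSucc = 0
    · have hn0 : n.val = 0 := by simpa [Fin.ext_iff] using hn
      rw [rootAct, rootCoeff_of_link (by simp) (.inl (by simp [Link, hn0]))]
      push_cast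
      rw [hn] at h1 h2 ⊢
      by_cases hm : m = 0
      · subst hm
        rw [actR0_zero_left _ (Fin.succ_ne_zero n), actR0_zero_zero]
        linear_combination h1 + hz0
      · rw [key _ _ hm (Fin.succ_ne_zero n), actR0_zero_right _ hm]
        linear_combination h2 + hz0
    · have hn0 : n.val ≠ 0 := by simpa [Fin.ext_iff] using hn
      rw [rootAct, rootCoeff_of_not_link (by simp) (by simp [Link, hn0])]
      push_cast
      by_cases hm : m = 0
      · subst hm
        rw [actR0_zero_left _ (Fin.succ_ne_zero n), actR0_zero_left _ hn]
        linear_combination h1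
      · rw [key _ _ hm (Fin.succ_ne_zero n), key _ _ hm hn]
        linear_combination h2

end AffineArrays

/-! ### Evaluation in the fundamental chamber and the vertex stabiliser. -/

section AffineAction
variable {k i j : ℕ}

theorem rootCoeff_inl_succ (a b : Fin k) : rootCoeff (.inl a.succ : Node k i j) (some (.inl b.succ)) =
    pathCoeff a b := by
  simp [rootCoeff, Link, pathCoeff]

theorem rootCoeff_inr_inl (a b : Fin i) :
    rootCoeff (.inr (.inl a) : Node k i j) (some (.inr (.inl b))) =
    pathCoeff a b := by
  simp only [rootCoeff, Link, pathCoeff, Sum.inl.injEq, Sum.inr.injEq]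
  congr

theorem rootCoeff_inr_inr (a b : Fin j) :
    rootCoeff (.inr (.inr a) : Node k i j) (some (.inr (.inr b))) =
    pathCoeff a b := by
  simp only [rootCoeff, Link, pathCoeff, Sum.inr.injEq]
  congr

variable {z : Pos k i j → ℂ} {v : Option (Node k i j) → ℝ}

theorem IsAffineArray.act_inl_succ (h : IsAffineArray z v) (a : Fin k) :
    IsAffineArray (act (.inl a.succ) z) (rootAct (.inl a.succ) v) := by
  constructor
  · change z (.inl (Equiv.swap a.castSucc a.succ (Fin.last k))) = _
    by_cases hk : a.succ = Fin.last k
    · rw [← hk, Equiv.swap_apply_right]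
      have h1 := h.head a
      have h2 := h.last
      rw [← hk] at h2
      simp only [rootAct, rootCoeff, hk, if_true]
      rw [hk] at h1 h2
      push_cast
      linear_combination h1 + h2
    · rw [Equiv.swap_apply_of_ne_of_ne (Fin.castSucc_lt_last a).ne' (Ne.symm hk)]
      simp [rootAct, rootCoeff, hk, h.last]
  · intro n
    have := sub_swap_adjacent (g := fun n => - z (.inl n)) (u := fun n => (v (some (.inl n.succ)) : ℂ))
      (fun n => by linear_combination h.head n) a n
    rw [rootAct, rootCoeff_inl_succ]
    change z (.inl (Equiv.swap a.castSucc a.succ n.castSucc)) -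
      z (.inl (Equiv.swap a.castSucc a.succ n.succ)) = _
    push_cast
    linear_combination this
  · change z (.inr (0, 0)) - z (.inl (Equiv.swap a.castSucc a.succ 0)) = _
    have hz := h.zero
    by_cases ha : a.castSucc = 0
    · have ha0 : a.val = 0 := by simpa [Fin.ext_iff] using ha
      rw [rootAct, rootCoeff_of_link (by simp) (.inr (by simp [Link, ha0]))]
      have h1 := h.head a
      rw [ha] at h1 ⊢
      rw [Equiv.swap_apply_left]
      push_cast
      linear_combination hz + h1
    · have ha0 : a.val ≠ 0 := by simpa [Fin.ext_iff] using ha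
      rw [rootAct, rootCoeff_of_not_link (by simp) (by simp [Link, ha0]),
        Equiv.swap_apply_of_ne_of_ne (Ne.symm ha) (Fin.succ_ne_zero a).symm, hz]
      simp
  · intro m n
    rw [rootAct, rootCoeff_of_not_link (by simp) (by simp [Link])]
    change z (.inr (m.succ, n)) - z (.inr (m.castSucc, n)) = _
    simp [h.col]
  · intro m n
    rw [rootAct, rootCoeff_of_not_link (by simp) (by simp [Link])]
    change z (.inr (m, n.succ)) - z (.inr (m, n.castSucc)) = _
    simp [h.row]

theorem IsAffineArray.act_inr_inl (h : IsAffineArray z v) (a : Fin i) :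
    IsAffineArray (act (.inr (.inl a)) z) (rootAct (.inr (.inl a)) v) := by
  constructor
  · change z (.inl (Fin.last k)) = _
    simp [rootAct, rootCoeff, h.last]
  · intro n
    rw [rootAct, rootCoeff_of_not_link (by simp) (by simp [Link])]
    change z (.inl n.castSucc) - z (.inl n.succ) = _
    simp [h.head]
  · change z (.inr (Equiv.swap a.castSucc a.succ 0, 0)) - z (.inl 0) = _
    have hz := h.zero
    by_cases ha : a.castSucc = 0
    · have ha0 : a.val = 0 := by simpa [Fin.ext_iff] using ha
      rw [rootAct, rootCoeff_of_link (by simp) (.inr (by simp [Link, ha0]))]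
      have h1 := h.col a 0
      rw [ha] at h1 ⊢
      rw [Equiv.swap_apply_left]
      push_cast
      linear_combination hz + h1
    · have ha0 : a.val ≠ 0 := by simpa [Fin.ext_iff] using ha
      rw [rootAct, rootCoeff_of_not_link (by simp) (by simp [Link, ha0]),
        Equiv.swap_apply_of_ne_of_ne (Ne.symm ha) (Fin.succ_ne_zero a).symm, hz]
      simp
  · intro m n
    have := sub_swap_adjacent (g := fun m => z (.inr (m, n)))
      (u := fun m => (v (some (.inr (.inl m))) : ℂ)) (fun m => h.col m n) a m
    rw [rootAct, rootCoeff_inr_inl]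
    refine Eq.trans this ?_
    push_cast
    rfl
  · intro m n
    rw [rootAct, rootCoeff_of_not_link (by simp) (by simp [Link])]
    change z (.inr (Equiv.swap a.castSucc a.succ m, n.succ)) -
      z (.inr (Equiv.swap a.castSucc a.succ m, n.castSucc)) = _
    simp [h.row]

theorem IsAffineArray.act_inr_inr (h : IsAffineArray z v) (a : Fin j) :
    IsAffineArray (act (.inr (.inr a)) z) (rootAct (.inr (.inr a)) v) := by
  constructor
  · change z (.inl (Fin.last k)) = _
    simp [rootAct, rootCoeff, h.last]
  · intro n
    rw [rootAct, rootCoeff_of_not_link (by simp) (by simp [Link])]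
    change z (.inl n.castSucc) - z (.inl n.succ) = _
    simp [h.head]
  · change z (.inr (0, Equiv.swap a.castSucc a.succ 0)) - z (.inl 0) = _
    have hz := h.zero
    by_cases ha : a.castSucc = 0
    · have ha0 : a.val = 0 := by simpa [Fin.ext_iff] using ha
      rw [rootAct, rootCoeff_of_link (by simp) (.inr (by simp [Link, ha0]))]
      have h1 := h.row 0 a
      rw [ha] at h1 ⊢
      rw [Equiv.swap_apply_left]
      push_cast
      linear_combination hz + h1
    · have ha0 : a.val ≠ 0 := by simpa [Fin.ext_iff] using ha
      rw [rootAct, rootCoeff_of_not_link (by simp) (by simp [Link, ha0]),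
        Equiv.swap_apply_of_ne_of_ne (Ne.symm ha) (Fin.succ_ne_zero a).symm, hz]
      simp
  · intro m n
    rw [rootAct, rootCoeff_of_not_link (by simp) (by simp [Link])]
    change z (.inr (m.succ, Equiv.swap a.castSucc a.succ n)) -
      z (.inr (m.castSucc, Equiv.swap a.castSucc a.succ n)) = _
    simp [h.col]
  · intro m n
    have := sub_swap_adjacent (g := fun n => z (.inr (m, n)))
      (u := fun n => (v (some (.inr (.inr n))) : ℂ)) (fun n => h.row m n) a n
    rw [rootAct, rootCoeff_inr_inr]
    refine Eq.trans this ?_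
    push_cast
    rfl

theorem IsAffineArray.act (h : IsAffineArray z v) (a : Node k i j) (hz : a = .inl 0 → Reg z) :
    IsAffineArray (act a z) (rootAct a v) := by
  rcases a with a | a | a
  · induction a using Fin.cases with
    | zero => exact h.actR0 (hz rfl)
    | succ a => exact h.act_inl_succ a
  · exact h.act_inr_inl a
  · exact h.act_inr_inr a

/-- Both differences are values of roots. The generators `t_m` move them to the first column, where
the roots are `t_1` and `r_0 + t_1`; the latter is the image of the simple root of `t_1` under
`r_0`. -/
theorem IsAffineArray.col_ne {w : W k i j} (h : IsAffineArray z (rootValue w)) (m : Fin i) :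
    z (.inr (m.succ, 0)) ≠ z (.inr (0, 0)) ∧ z (.inr (m.succ, 0)) ≠ z (.inl 0) := by
  obtain ⟨m, hm⟩ := m
  induction m generalizing w z with
  | zero =>
    have h1 := h.col ⟨0, hm⟩ 0
    have h2 := h.zero
    have h3 := rootValue_ne_zero w (.inr (.inl ⟨0, hm⟩))
    have h4 := rootValue_ne_zero (w * gen (.inl 0)) (.inr (.inl ⟨0, hm⟩))
    rw [rootValue_mul_gen, rootAct, rootCoeff_of_link (by simp) (.inl (by simp [Link]))] at h4
    have e : (⟨0, hm⟩ : Fin i).castSucc = 0 := by ext; simp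
    rw [e] at h1
    refine ⟨fun h0 => h3 ?_, fun h0 => h4 ?_⟩
    · rw [h0, sub_self] at h1
      exact_mod_cast h1.symm
    · rw [h0] at h1
      have : (((rootValue w (some (.inr (.inl ⟨0, hm⟩))) + 1 * rootValue w (some (.inl 0)) : ℝ)) : ℂ)
          = 0 := by
        push_cast
        linear_combination -h1 - h2
      exact_mod_cast this
  | succ m ih =>
    have h' := h.act_inr_inl ⟨m + 1, hm⟩
    rw [← rootValue_mul_gen] at h'
    have := ih h' (by omega)
    have e : (⟨m, by omega⟩ : Fin i).succ = (⟨m + 1, hm⟩ : Fin i).castSucc := rfl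
    have e0 : (Equiv.swap (⟨m + 1, hm⟩ : Fin i).castSucc (⟨m + 1, hm⟩ : Fin i).succ) 0 = 0 :=
      Equiv.swap_apply_of_ne_of_ne (by simp [Fin.ext_iff]) (by simp [Fin.ext_iff])
    simp only [GossetElte.act, Sum.map_inr, Sum.map_inl, Prod.map, id, e, e0,
      Equiv.swap_apply_left] at this
    exact this

theorem IsAffineArray.row_ne {w : W k i j} (h : IsAffineArray z (rootValue w)) (n : Fin j) :
    z (.inr (0, n.succ)) ≠ z (.inr (0, 0)) ∧ z (.inr (0, n.succ)) ≠ z (.inl 0) := by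
  obtain ⟨n, hn⟩ := n
  induction n generalizing w z with
  | zero =>
    have h1 := h.row 0 ⟨0, hn⟩
    have h2 := h.zero
    have h3 := rootValue_ne_zero w (.inr (.inr ⟨0, hn⟩))
    have h4 := rootValue_ne_zero (w * gen (.inl 0)) (.inr (.inr ⟨0, hn⟩))
    rw [rootValue_mul_gen, rootAct, rootCoeff_of_link (by simp) (.inl (by simp [Link]))] at h4
    have e : (⟨0, hn⟩ : Fin j).castSucc = 0 := by ext; simp
    rw [e] at h1
    refine ⟨fun h0 => h3 ?_, fun h0 => h4 ?_⟩
    · rw [h0, sub_self] at h1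
      exact_mod_cast h1.symm
    · rw [h0] at h1
      have : (((rootValue w (some (.inr (.inr ⟨0, hn⟩))) + 1 * rootValue w (some (.inl 0)) : ℝ)) : ℂ)
          = 0 := by
        push_cast
        linear_combination -h1 - h2
      exact_mod_cast this
  | succ n ih =>
    have h' := h.act_inr_inr ⟨n + 1, hn⟩
    rw [← rootValue_mul_gen] at h'
    have := ih h' (by omega)
    have e : (⟨n, by omega⟩ : Fin j).succ = (⟨n + 1, hn⟩ : Fin j).castSucc := rfl
    have e0 : (Equiv.swap (⟨n + 1, hn⟩ : Fin j).castSucc (⟨n + 1, hn⟩ : Fin j).succ) 0 = 0 :=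
      Equiv.swap_apply_of_ne_of_ne (by simp [Fin.ext_iff]) (by simp [Fin.ext_iff])
    simp only [GossetElte.act, Sum.map_inr, Sum.map_inl, Prod.map, id, e, e0,
      Equiv.swap_apply_left] at this
    exact this

/-- On an affine array `sixthDen` factors as `(y_{m0} - y_{00}) (y_{0n} - y_{00})`, so root values
being nonzero suffices. -/
theorem IsAffineArray.reg {w : W k i j} (h : IsAffineArray z (rootValue w)) : Reg z := by
  intro m n hm hn
  obtain ⟨m, rfl⟩ := Fin.exists_succ_eq.2 hm
  obtain ⟨n, rfl⟩ := Fin.exists_succ_eq.2 hn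
  obtain ⟨h1, h2⟩ := h.col_ne m
  obtain ⟨h3, h4⟩ := h.row_ne n
  refine ⟨⟨h4.symm, h2.symm, h3.symm, h1.symm⟩, ?_⟩
  have : sixthDen (z (.inl 0)) (z (.inr (0, n.succ))) (z (.inr (0, 0))) (z (.inr (m.succ, n.succ)))
      (z (.inr (m.succ, 0))) = (z (.inr (m.succ, 0)) - z (.inr (0, 0))) *
        (z (.inr (0, n.succ)) - z (.inr (0, 0))) := by
    rw [h.apply m.succ n.succ]
    unfold sixthDen
    ring
  rw [this]
  exact mul_ne_zero (sub_ne_zero.2 h1) (sub_ne_zero.2 h3)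

/-- An array in the fundamental chamber. -/
def chamberArray (k i j : ℕ) : Pos k i j → ℂ
  | .inl n => k - n.val
  | .inr (m, n) => k + 1 + m.val + n.val

theorem isAffineArray_chamberArray :
    IsAffineArray (chamberArray k i j) (rootValue (1 : W k i j)) := by
  constructor
  · simp [chamberArray, rootValue_one]
  · intro n
    simp [chamberArray, rootValue_one]
  · simp [chamberArray, rootValue_one]
  · intro m n
    simp [chamberArray, rootValue_one]
  · intro m n
    simp [chamberArray, rootValue_one]

/-- A single point at which the images of the variables under the whole group are regular.
Regularity and affineness have to be carried along the word together. -/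
theorem exists_arrayValue_chamberArray (w : W k i j) : ∃ z : Pos k i j → ℂ,
    ArrayValue (fun p => birationalAction k i j w (var p)) (chamberArray k i j) z ∧
      IsAffineArray z (rootValue w) := by
  induction w using gen_induction with
  | one => exact ⟨_, by simpa using arrayValue_var _, isAffineArray_chamberArray⟩
  | mul_gen w a ih =>
    obtain ⟨z, h, h'⟩ := ih
    rw [birationalAction_mul_gen_var, rootValue_mul_gen]
    exact ⟨_, h.act fun _ => h'.reg, h'.act a fun _ => h'.reg⟩

/-- The stabiliser of the last variable under the birational action is the stabiliser of the
base vertex. -/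
theorem mem_vertexStabilizer_of_fixes {w : W k i j}
    (h : birationalAction k i j w (var (.inl (Fin.last k))) = var (.inl (Fin.last k))) :
    w ∈ vertexStabilizer k i j := by
  obtain ⟨z, hz, hz'⟩ := exists_arrayValue_chamberArray w
  have h1 := hz (.inl (Fin.last k))
  simp only [h] at h1
  have h2 := h1.unique (hasValueAt_var _)
  -- The entry `y_k` of the chamber array is `k - k = 0`, so the weight coordinate of `w` vanishes.
  rw [hz'.last] at h2
  refine (rootValue_none w).2 ?_
  simpa [chamberArray] using h2

theorem fixes_of_mem_vertexStabilizer {w : W k i j} (hw : w ∈ vertexStabilizer k i j) :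
    birationalAction k i j w (var (.inl (Fin.last k))) = var (.inl (Fin.last k)) := by
  induction hw using Subgroup.closure_induction with
  | mem x hx =>
    obtain ⟨a, ha, rfl⟩ := hx
    rw [birationalAction_gen_var]
    rcases a with a | a | a
    · induction a using Fin.cases with
      | zero =>
        have : Fin.last k ≠ 0 := fun h => ha (by rw [h])
        exact actR0_inl _ this
      | succ a =>
        have : Fin.last k ≠ a.succ := fun h => ha (by rw [h])
        rw [act_apply (by simp)]
        congr 1
        exact congrArg Sum.inl
          (Equiv.swap_apply_of_ne_of_ne (Fin.castSucc_lt_last a).ne' this)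
    · rfl
    · rfl
  | one => simp
  | mul x y _ _ hx hy => rw [map_mul, AlgEquiv.mul_apply, hy, hx]
  | inv x _ hx =>
    rw [map_inv]
    nth_rw 1 [← hx]
    exact AlgEquiv.symm_apply_apply _ _

end AffineAction

/-! ### Circles through a point as lines, and Menelaus' theorem. -/

section Lines

/-- A coordinate of `ℂ ∪ {∞}` with pole at `P`, taking the circles through `P` to lines. -/
noncomputable def polarCoord : OnePoint ℂ → OnePoint ℂ → ℂ
  | ∞, ∞ => 0
  | ∞, (z : ℂ) => z
  | (_ : ℂ), ∞ => 0
  | (P : ℂ), (z : ℂ) => (z - P)⁻¹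

@[simp] theorem polarCoord_infty_coe (z : ℂ) : polarCoord ∞ (z : OnePoint ℂ) = z := rfl
@[simp] theorem polarCoord_coe_infty (P : ℂ) : polarCoord (P : OnePoint ℂ) ∞ = 0 := rfl
@[simp] theorem polarCoord_coe_coe (P z : ℂ) :
    polarCoord (P : OnePoint ℂ) (z : OnePoint ℂ) = (z - P)⁻¹ := rfl

theorem polarCoord_injOn (P : OnePoint ℂ) : Set.InjOn (polarCoord P) {P}ᶜ := by
  intro x hx y hy h
  induction P using OnePoint.rec with
  | infty =>
    induction x using OnePoint.rec with
    | infty => exact absurd rfl hx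
    | coe x =>
      induction y using OnePoint.rec with
      | infty => exact absurd rfl hy
      | coe y => simpa using h
  | coe P =>
    have aux {z : ℂ} (hz : (z : OnePoint ℂ) ∈ ({(P : OnePoint ℂ)}ᶜ : Set (OnePoint ℂ))) :
        z - P ≠ 0 := by
      rintro h0
      exact hz (by simp [sub_eq_zero.1 h0])
    induction x using OnePoint.rec with
    | infty =>
      induction y using OnePoint.rec with
      | infty => rfl
      | coe y =>
        have := aux hy
        simp only [polarCoord_coe_infty, polarCoord_coe_coe] at h
        exact absurd h.symm (inv_ne_zero this)
    | coe x =>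
      induction y using OnePoint.rec with
      | infty =>
        have := aux hx
        simp only [polarCoord_coe_infty, polarCoord_coe_coe] at h
        exact absurd h (inv_ne_zero this)
      | coe y => simpa using h

theorem exists_real_param_iff {d : ℂ} (hd : d ≠ 0) (w : ℂ) :
    (∃ t : ℝ, w = t * d) ↔ (w * starRingEnd ℂ d).im = 0 := by
  constructor
  · rintro ⟨t, rfl⟩
    simp [Complex.mul_im, Complex.mul_re]
    ring
  · intro h
    have hn : (Complex.normSq d : ℂ) ≠ 0 := by simpa using hd
    refine ⟨(w * starRingEnd ℂ d).re / Complex.normSq d, ?_⟩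
    have h1 : w * starRingEnd ℂ d = ((w * starRingEnd ℂ d).re : ℂ) := by
      apply Complex.ext <;> simp [h]
    push_cast
    rw [← h1, div_mul_eq_mul_div, eq_div_iff hn, Complex.normSq_eq_conj_mul_self]
    ring

theorem IsCircle.exists_line {c : Set (OnePoint ℂ)} (hc : IsCircle c) {P : OnePoint ℂ}
    (hP : P ∈ c) : ∃ (n : ℂ) (s : ℝ), n ≠ 0 ∧
      ∀ z, z ≠ P → (z ∈ c ↔ (n * polarCoord P z).re = s) := by
  rcases hc with ⟨o, r, hr, rfl⟩ | ⟨p, d, hd, rfl⟩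
  · obtain ⟨P, hP, rfl⟩ := hP
    have hP' : ‖P - o‖ = r := by simpa [dist_eq_norm] using hP
    have hPo : P - o ≠ 0 := by
      intro h0
      rw [h0, norm_zero] at hP'
      exact hr.ne hP'
    -- Since `P` is on the circle, `|z - o|² = |P - o|²` reads `|z - P|² + 2 Re((P - o) conj(z - P))
    -- = 0`; division by `|z - P|²` gives the constant.
    refine ⟨P - o, -1 / 2, hPo, fun z hz => ?_⟩
    induction z using OnePoint.rec with
    | infty => norm_num
    | coe z =>
      have hzP : z - P ≠ 0 := sub_ne_zero.2 fun h => hz (by rw [h])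
      have hn : Complex.normSq (z - P) ≠ 0 := by simpa using hzP
      have h1 : ((z : OnePoint ℂ) ∈ (fun w : ℂ => (w : OnePoint ℂ)) '' Metric.sphere o r) ↔
          Complex.normSq (z - o) = Complex.normSq (P - o) := by
        rw [Complex.normSq_eq_norm_sq, Complex.normSq_eq_norm_sq, hP']
        constructor
        · rintro ⟨w, hw, hwz⟩
          obtain rfl : w = z := by simpa using hwz
          have : ‖w - o‖ = r := by simpa [dist_eq_norm] using hw
          rw [this]
        · intro h
          refine ⟨z, ?_, rfl⟩
          simpa [dist_eq_norm] using (sq_eq_sq₀ (norm_nonneg _) hr.le).1 h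
      rw [h1, polarCoord_coe_coe, Complex.inv_def]
      have e : Complex.normSq (z - o) - Complex.normSq (P - o) = Complex.normSq (z - P) +
          2 * ((P - o) * starRingEnd ℂ (z - P)).re := by
        simp only [Complex.normSq_apply, Complex.mul_re, Complex.sub_re, Complex.sub_im,
          Complex.conj_re, Complex.conj_im]
        ring
      have e2 : ((P - o) * (starRingEnd ℂ (z - P) * (((Complex.normSq (z - P))⁻¹ : ℝ) : ℂ))).re =
          ((P - o) * starRingEnd ℂ (z - P)).re / Complex.normSq (z - P) := by
        rw [← mul_assoc, Complex.re_mul_ofReal, div_eq_mul_inv]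
      rw [e2, div_eq_iff hn]
      constructor <;> intro h <;> linarith
  · induction P using OnePoint.rec with
    | infty =>
      refine ⟨-Complex.I * starRingEnd ℂ d, (-Complex.I * starRingEnd ℂ d * p).re, by simp [hd],
        fun z hz => ?_⟩
      induction z using OnePoint.rec with
      | infty => exact absurd rfl hz
      | coe z =>
        have : ((z : OnePoint ℂ) ∈ insert ∞ ((fun w : ℂ => (w : OnePoint ℂ)) ''
            {z | ∃ t : ℝ, z = p + (t : ℂ) * d})) ↔ ∃ t : ℝ, z - p = t * d := by
          simp [sub_eq_iff_eq_add']
        rw [this, exists_real_param_iff hd, polarCoord_infty_coe]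
        simp only [Complex.mul_im, Complex.sub_re, Complex.sub_im, Complex.conj_re,
          Complex.conj_im, Complex.mul_re, Complex.neg_re, Complex.neg_im, Complex.I_re,
          Complex.I_im]
        constructor <;> intro h <;> linarith
    | coe P =>
      obtain ⟨t0, ht0⟩ : ∃ t : ℝ, P = p + t * d := by simpa using hP
      -- A straight line through `P` also contains `∞`, whose coordinate is `0`, so its image passes
      -- through the origin.
      refine ⟨-Complex.I * d, 0, by simp [hd], fun z hz => ?_⟩
      induction z using OnePoint.rec with
      | infty => simp
      | coe z =>
        have hzP : z - P ≠ 0 := sub_ne_zero.2 fun h => hz (by rw [h])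
        have hn : Complex.normSq (z - P) ≠ 0 := by simpa using hzP
        have : ((z : OnePoint ℂ) ∈ insert ∞ ((fun w : ℂ => (w : OnePoint ℂ)) ''
            {z | ∃ t : ℝ, z = p + (t : ℂ) * d})) ↔ ∃ t : ℝ, z - P = t * d := by
          simp only [Set.mem_insert_iff, OnePoint.coe_ne_infty, false_or, Set.mem_image,
            OnePoint.coe_eq_coe, exists_eq_right, Set.mem_ofPred_eq, ht0]
          constructor
          · rintro ⟨t, ht⟩
            exact ⟨t - t0, by push_cast; linear_combination ht⟩
          · rintro ⟨t, ht⟩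
            exact ⟨t + t0, by push_cast; linear_combination ht⟩
        rw [this, exists_real_param_iff hd, polarCoord_coe_coe, Complex.inv_def]
        have e2 : (-Complex.I * d * (starRingEnd ℂ (z - P) *
            (((Complex.normSq (z - P))⁻¹ : ℝ) : ℂ))).re =
            (-Complex.I * d * starRingEnd ℂ (z - P)).re / Complex.normSq (z - P) := by
          rw [← mul_assoc, Complex.re_mul_ofReal, div_eq_mul_inv]
        rw [e2, div_eq_zero_iff, or_iff_left hn]
        simp only [Complex.mul_im, Complex.sub_re, Complex.sub_im, Complex.conj_re,
          Complex.conj_im, Complex.mul_re, Complex.neg_re, Complex.neg_im, Complex.I_re,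
          Complex.I_im]
        constructor <;> intro h <;> linarith

theorem exists_real_mul_of_re_eq {n : ℂ} (hn : n ≠ 0) {v w : ℂ} {s : ℝ} (hv : (n * v).re = s)
    (hw : (n * w).re = s) : ∃ t : ℝ, w = v + t * (Complex.I / n) := by
  refine ⟨(n * (w - v)).im, ?_⟩
  have h0 : (n * (w - v)).re = 0 := by rw [mul_sub, Complex.sub_re, hv, hw, sub_self]
  have h1 : n * (w - v) = ((n * (w - v)).im : ℂ) * Complex.I := by
    apply Complex.ext <;> simp only [Complex.re_ofReal_mul, Complex.im_ofReal_mul, Complex.I_re,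
      Complex.I_im, h0] <;> ring
  rw [← mul_div_assoc, ← h1]
  field_simp
  ring

/-- Menelaus' theorem for four lines, in terms of their points of intersection. -/
theorem quadPoly_eq_zero_of_lines {v12 v13 v14 v23 v24 v34 n0 n1 n2 n3 : ℂ} {s0 s1 s2 s3 : ℝ}
    (hn0 : n0 ≠ 0) (hn1 : n1 ≠ 0) (hn2 : n2 ≠ 0) (hn3 : n3 ≠ 0)
    (h1314 : v13 ≠ v14) (h2324 : v23 ≠ v24)
    (hne : ¬ ∀ u : ℂ, (n0 * u).re = s0 ↔ (n3 * u).re = s3)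
    (h012 : (n0 * v12).re = s0) (h013 : (n0 * v13).re = s0) (h023 : (n0 * v23).re = s0)
    (h312 : (n3 * v12).re = s3) (h314 : (n3 * v14).re = s3) (h324 : (n3 * v24).re = s3)
    (h213 : (n2 * v13).re = s2) (h214 : (n2 * v14).re = s2) (h234 : (n2 * v34).re = s2)
    (h123 : (n1 * v23).re = s1) (h124 : (n1 * v24).re = s1) (h134 : (n1 * v34).re = s1) :
    quadPoly v12 v13 v14 v23 v24 v34 = 0 := by
  obtain ⟨a, ha⟩ := exists_real_mul_of_re_eq hn0 h012 h013
  obtain ⟨b, hb⟩ := exists_real_mul_of_re_eq hn0 h012 h023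
  obtain ⟨c, hc⟩ := exists_real_mul_of_re_eq hn3 h312 h314
  obtain ⟨e, he⟩ := exists_real_mul_of_re_eq hn3 h312 h324
  obtain ⟨f, hf⟩ : ∃ f : ℝ, v34 = v13 + f * (v14 - v13) := by
    obtain ⟨f1, hf1⟩ := exists_real_mul_of_re_eq hn2 h213 h214
    obtain ⟨f2, hf2⟩ := exists_real_mul_of_re_eq hn2 h213 h234
    have : (f1 : ℂ) ≠ 0 := by
      intro h0
      rw [h0, zero_mul, add_zero] at hf1
      exact h1314 hf1.symm
    refine ⟨f2 / f1, ?_⟩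
    rw [hf1, hf2]
    push_cast
    field_simp
    ring
  obtain ⟨g, hg⟩ : ∃ g : ℝ, v34 = v23 + g * (v24 - v23) := by
    obtain ⟨f1, hf1⟩ := exists_real_mul_of_re_eq hn1 h123 h124
    obtain ⟨f2, hf2⟩ := exists_real_mul_of_re_eq hn1 h123 h134
    have : (f1 : ℂ) ≠ 0 := by
      intro h0
      rw [h0, zero_mul, add_zero] at hf1
      exact h2324 hf1.symm
    refine ⟨f2 / f1, ?_⟩
    rw [hf1, hf2]
    push_cast
    field_simp
    ring
  -- The directions of the lines `0` and `3` are independent over `ℝ`: parallel lines with the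
  -- common point `v12` would coincide.
  have hind (x y : ℝ) (h : (x : ℂ) * (Complex.I / n0) + y * (Complex.I / n3) = 0) :
      x = 0 ∧ y = 0 := by
    have h' : (x : ℂ) * n3 + y * n0 = 0 := by
      field_simp at h
      apply mul_left_cancel₀ Complex.I_ne_zero
      linear_combination h
    by_contra hxy
    have hx : x ≠ 0 := by
      rintro rfl
      simp_all
    have hy : y ≠ 0 := by
      rintro rfl
      simp_all
    apply hne
    have key (u : ℂ) : x * (n3 * u).re + y * (n0 * u).re = 0 := by
      have := congrArg (fun w => (w * u).re) h'
      simpa [add_mul, mul_assoc] using this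
    intro u
    have k1 := key u
    have k2 := key v12
    rw [h012, h312] at k2
    constructor
    · intro hu
      rw [hu] at k1
      exact mul_left_cancel₀ hx (by linarith)
    · intro hu
      rw [hu] at k1
      exact mul_left_cancel₀ hy (by linarith)
  -- The two expressions for `v34`, on the lines `v13 v14` and `v23 v24`, are compared in these
  -- directions.
  obtain ⟨h1, h2⟩ := hind (a * (1 - f) - b * (1 - g)) (f * c - g * e) (by
    push_cast
    rw [hg, ha, hb, hc, he] at hf
    linear_combination -hf)
  have h1' : (a : ℂ) * (1 - f) - b * (1 - g) = 0 := by exact_mod_cast h1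
  have h2' : (f : ℂ) * c - g * e = 0 := by exact_mod_cast h2
  rw [hf, ha, hb, hc, he]
  unfold quadPoly
  linear_combination -(Complex.I / n0) * (Complex.I / n3) *
    (c * (Complex.I / n3) - a * (Complex.I / n0)) * (e * h1' + b * h2')

/-- The sixth point of a `C₄` pattern is determined by the others. -/
theorem IsC4.eq_sixth {x12 x13 x14 x23 x24 : ℂ} {X : OnePoint ℂ}
    (h : IsC4 x12 x13 x14 x23 x24 X) (hden : sixthDen x12 x13 x14 x23 x24 ≠ 0) :
    X = ((sixth x12 x13 x14 x23 x24 : ℂ) : OnePoint ℂ) := by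
  obtain ⟨P, Q, c, d, hnd, hinj, hc, -, hc0, hc1, hc2, hc3, hP, -⟩ := h
  simp only [List.nodup_cons, List.mem_cons, List.not_mem_nil, or_false, not_or] at hnd
  simp only [Set.insert_subset_iff, Set.singleton_subset_iff] at hc0 hc1 hc2 hc3
  have p12 : (x12 : OnePoint ℂ) ≠ P := by tauto
  have p13 : (x13 : OnePoint ℂ) ≠ P := by tauto
  have p14 : (x14 : OnePoint ℂ) ≠ P := by tauto
  have p23 : (x23 : OnePoint ℂ) ≠ P := by tauto
  have p24 : (x24 : OnePoint ℂ) ≠ P := by tauto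
  have p34 : X ≠ P := by tauto
  have d1314 : (x13 : OnePoint ℂ) ≠ x14 := by tauto
  have d2324 : (x23 : OnePoint ℂ) ≠ x24 := by tauto
  choose n s hn hl using fun a => (hc a).exists_line (hP a)
  have hne : ¬ ∀ u : ℂ, (n 0 * u).re = s 0 ↔ (n 3 * u).re = s 3 := by
    intro hu
    have : c 0 = c 3 := by
      ext z
      by_cases hz : z = P
      · subst hz
        simp [hP]
      · rw [hl 0 z hz, hl 3 z hz, hu]
    have := hinj (a₁ := Sum.inl 0) (a₂ := Sum.inl 3) this
    simp at this
  have hq := quadPoly_eq_zero_of_lines (hn 0) (hn 1) (hn 2) (hn 3)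
    (fun h => d1314 (polarCoord_injOn P p13 p14 h)) (fun h => d2324 (polarCoord_injOn P p23 p24 h))
    hne ((hl 0 _ p12).1 hc0.1) ((hl 0 _ p13).1 hc0.2.2) ((hl 0 _ p23).1 hc0.2.1)
    ((hl 3 _ p12).1 hc3.1) ((hl 3 _ p14).1 hc3.2.2) ((hl 3 _ p24).1 hc3.2.1)
    ((hl 2 _ p13).1 hc2.1) ((hl 2 _ p14).1 hc2.2.2) ((hl 2 _ p34).1 hc2.2.1)
    ((hl 1 _ p23).1 hc1.1) ((hl 1 _ p24).1 hc1.2.2) ((hl 1 _ p34).1 hc1.2.1)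
  -- It remains to undo the inversion; the multi-ratio is invariant under `z ↦ 1 / (z - P)`.
  induction P using OnePoint.rec with
  | infty =>
    induction X using OnePoint.rec with
    | infty => exact absurd rfl p34
    | coe X =>
      simp only [polarCoord_infty_coe] at hq
      rw [(eq_sixth_iff hden).2 hq]
  | coe P =>
    have aux {z : ℂ} (hz : (z : OnePoint ℂ) ≠ P) : z - P ≠ 0 := by
      rintro h0
      exact hz (by simp [sub_eq_zero.1 h0])
    replace p12 := aux p12
    replace p13 := aux p13
    replace p14 := aux p14
    replace p23 := aux p23
    replace p24 := aux p24
    induction X using OnePoint.rec with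
    | infty =>
      -- The point `∞` has coordinate `0`, and the equation then says that the denominator of the
      -- sixth point vanishes.
      simp only [polarCoord_coe_coe, polarCoord_coe_infty] at hq
      exfalso
      apply hden
      unfold quadPoly at hq
      unfold sixthDen
      field_simp at hq
      linear_combination -hq
    | coe X =>
      replace p34 := aux p34
      simp only [polarCoord_coe_coe] at hq
      refine congrArg _ ((eq_sixth_iff hden).2 ?_)
      unfold quadPoly at hq ⊢
      field_simp at hq
      linear_combination -hq

end Lines

/-! ### Concyclic points and the concurrence of four circles. -/

section Concyclic

/-- A function vanishing iff the four points are on a circle or a line. -/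
noncomputable def concyclicPoly (z a b c : ℂ) : ℂ :=
  (z - a) * (b - c) * starRingEnd ℂ ((z - c) * (b - a)) -
    starRingEnd ℂ ((z - a) * (b - c)) * ((z - c) * (b - a))

/-- A function vanishing iff the three points are collinear. -/
noncomputable def collinearPoly (a b c : ℂ) : ℂ :=
  (b - c) * starRingEnd ℂ (b - a) - starRingEnd ℂ (b - c) * (b - a)

/-- Reality of a cross-ratio `X / Y`, in a form that allows either term to vanish. -/
theorem mul_conj_sub_eq_zero {X Y : ℂ} {α β : ℝ} (hαβ : α ≠ 0 ∨ β ≠ 0)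
    (h : (α : ℂ) * X = β * Y) : X * starRingEnd ℂ Y - starRingEnd ℂ X * Y = 0 := by
  have h' : (α : ℂ) * starRingEnd ℂ X = β * starRingEnd ℂ Y := by
    simpa using congrArg (starRingEnd ℂ) h
  rcases hαβ with h0 | h0
  · apply mul_left_cancel₀ (Complex.ofReal_ne_zero.2 h0)
    linear_combination starRingEnd ℂ Y * h - Y * h'
  · apply mul_left_cancel₀ (Complex.ofReal_ne_zero.2 h0)
    linear_combination starRingEnd ℂ X * h - X * h'

/-- The circle through three noncollinear points. -/
theorem exists_sphere {a b c : ℂ} (h : collinearPoly a b c ≠ 0) :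
    ∃ (o : ℂ) (r : ℝ), 0 < r ∧ ∀ z, z ∈ Metric.sphere o r ↔ concyclicPoly z a b c = 0 := by
  -- The circumcentre, from the equations `|o - a|² = |o - b|² = |o - c|²`, which are linear in `o`
  -- and its conjugate.
  obtain ⟨o, ho⟩ : ∃ o : ℂ, o = -(a * starRingEnd ℂ a * (b - c) + b * starRingEnd ℂ b * (c - a) +
    c * starRingEnd ℂ c * (a - b)) / collinearPoly a b c := ⟨_, rfl⟩
  have hconj : starRingEnd ℂ (collinearPoly a b c) = - collinearPoly a b c := by
    simp [collinearPoly]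
  have h1 : o * collinearPoly a b c = -(a * starRingEnd ℂ a * (b - c) +
      b * starRingEnd ℂ b * (c - a) + c * starRingEnd ℂ c * (a - b)) := by
    rw [ho, div_mul_cancel₀ _ h]
  have h2 : starRingEnd ℂ o * collinearPoly a b c = a * starRingEnd ℂ a * starRingEnd ℂ (b - c) +
      b * starRingEnd ℂ b * starRingEnd ℂ (c - a) + c * starRingEnd ℂ c * starRingEnd ℂ (a - b) := by
    have := congrArg (starRingEnd ℂ) h1
    simp only [map_mul, hconj, map_add, map_neg, map_sub, Complex.conj_conj] at this ⊢
    linear_combination -this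
  have key (z : ℂ) : collinearPoly a b c * ((z - o) * starRingEnd ℂ (z - o) -
      (a - o) * starRingEnd ℂ (a - o)) = concyclicPoly z a b c := by
    have e : collinearPoly a b c * ((z - o) * starRingEnd ℂ (z - o) -
      (a - o) * starRingEnd ℂ (a - o)) = collinearPoly a b c * (z * starRingEnd ℂ z -
        a * starRingEnd ℂ a) - (z - a) * (starRingEnd ℂ o * collinearPoly a b c) -
        (starRingEnd ℂ z - starRingEnd ℂ a) * (o * collinearPoly a b c) := by
      simp only [map_sub]
      ring
    rw [e, h1, h2]
    simp only [collinearPoly, concyclicPoly, map_sub, map_mul]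
    ring
  have hmem (z : ℂ) : z ∈ Metric.sphere o ‖a - o‖ ↔ concyclicPoly z a b c = 0 := by
    rw [← key, mul_eq_zero, or_iff_right h, Complex.mul_conj, Complex.mul_conj, sub_eq_zero,
      Complex.ofReal_inj, Complex.normSq_eq_norm_sq, Complex.normSq_eq_norm_sq,
      sq_eq_sq₀ (norm_nonneg _) (norm_nonneg _), mem_sphere_iff_norm]
  refine ⟨o, ‖a - o‖, norm_pos_iff.2 fun h0 => h ?_, hmem⟩
  have hb : b ∈ Metric.sphere o ‖a - o‖ := (hmem b).2 (by simp only [concyclicPoly, map_mul]; ring)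
  rw [h0] at hb
  have : b = a := by
    rw [sub_eq_zero.1 h0]
    simpa using hb
  simp [collinearPoly, this]

theorem exists_real_combination {p q : ℂ} (h : p * starRingEnd ℂ q - starRingEnd ℂ p * q ≠ 0)
    (w : ℂ) : ∃ s t : ℝ, w = t * q - s * p := by
  have h' : p.re * q.im - p.im * q.re ≠ 0 := by
    intro h0
    apply h
    apply Complex.ext
    · simp
    · simp
      linear_combination -2 * h0
  refine ⟨(w.im * q.re - w.re * q.im) / (p.re * q.im - p.im * q.re),
    (w.im * p.re - w.re * p.im) / (p.re * q.im - p.im * q.re), ?_⟩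
  apply Complex.ext <;> simp only [Complex.sub_re, Complex.sub_im, Complex.re_ofReal_mul,
    Complex.im_ofReal_mul] <;> field_simp <;> ring

/-- Four circles through the faces of an octahedron concur. -/
theorem exists_concurrence {x12 x13 x14 x23 x24 x34 : ℂ}
    (hq : quadPoly x12 x13 x14 x23 x24 x34 = 0)
    (h13 : x13 ≠ x12) (h14 : x14 ≠ x12) (h23 : x23 ≠ x12) (h24 : x24 ≠ x12) (h34 : x34 ≠ x12)
    (h1314 : x13 ≠ x14) (h2324 : x23 ≠ x24) (h1424 : x14 ≠ x24)
    (hcol : collinearPoly x12 x23 x13 ≠ 0) (hcon : concyclicPoly x12 x13 x34 x14 ≠ 0) :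
    ∃ P, concyclicPoly P x12 x23 x13 = 0 ∧ concyclicPoly P x23 x34 x24 = 0 ∧
      concyclicPoly P x13 x34 x14 = 0 ∧ concyclicPoly P x12 x24 x14 = 0 := by
  -- Inversion at `x12` makes lines of the two circles through `x12`; their other common point will
  -- be `P`.
  have aux {z : ℂ} (hz : z ≠ x12) : ∃ u : ℂ, u ≠ 0 ∧ z = x12 + u⁻¹ :=
    ⟨(z - x12)⁻¹, inv_ne_zero (sub_ne_zero.2 hz), by simp⟩
  obtain ⟨u13, n13, rfl⟩ := aux h13
  obtain ⟨u14, n14, rfl⟩ := aux h14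
  obtain ⟨u23, n23, rfl⟩ := aux h23
  obtain ⟨u24, n24, rfl⟩ := aux h24
  obtain ⟨u34, n34, rfl⟩ := aux h34
  have e1314 : u13 ≠ u14 := fun h => h1314 (by rw [h])
  have e2324 : u23 ≠ u24 := fun h => h2324 (by rw [h])
  have e1424 : u14 ≠ u24 := fun h => h1424 (by rw [h])
  have hI : (u13 - u23) * (u34 - u14) = (u14 - u24) * (u34 - u13) := by
    unfold quadPoly at hq
    field_simp at hq
    linear_combination hq
  obtain ⟨p, hp⟩ : ∃ p, p = u13 - u23 := ⟨_, rfl⟩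
  obtain ⟨q, hq'⟩ : ∃ q, q = u14 - u24 := ⟨_, rfl⟩
  have hq0 : q ≠ 0 := by rw [hq']; exact sub_ne_zero.2 e1424
  rw [← hp, ← hq'] at hI
  -- If the two lines were parallel, the multi-ratio equation would make `u13, u14, u34` collinear,
  -- that is, `x12, x13, x34, x14` concyclic.
  have hpq : p * starRingEnd ℂ q - starRingEnd ℂ p * q ≠ 0 := by
    intro h0
    obtain ⟨ρ, hρ⟩ : ∃ ρ : ℝ, p = ρ * q := by
      rw [exists_real_param_iff hq0]
      have := congrArg Complex.im h0
      simp [Complex.mul_im] at this ⊢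
      linarith
    apply hcon
    have : ((ρ : ℝ) : ℂ) * ((x12 - (x12 + u13⁻¹)) * (x12 + u34⁻¹ - (x12 + u14⁻¹))) =
        ((1 : ℝ) : ℂ) * ((x12 - (x12 + u14⁻¹)) * (x12 + u34⁻¹ - (x12 + u13⁻¹))) := by
      rw [hρ] at hI
      have hI' : ρ * (u34 - u14) = u34 - u13 := mul_left_cancel₀ hq0 (by linear_combination hI)
      push_cast
      field_simp
      linear_combination hI'
    exact mul_conj_sub_eq_zero (.inr one_ne_zero) this
  obtain ⟨s, t, hst⟩ := exists_real_combination hpq (u13 - u14)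
  obtain ⟨U, hU⟩ : ∃ U, U = u13 + s * p := ⟨_, rfl⟩
  have e13 : u13 = U - s * p := by rw [hU]; ring
  have e14 : u14 = U - t * q := by rw [hU]; linear_combination -hst
  have e23 : u23 = U - (s + 1) * p := by rw [hU]; linear_combination hp
  have e24 : u24 = U - (t + 1) * q := by rw [hU]; linear_combination hq' - hst
  -- The intersection `U = 0` would put `P` at `∞`, making `x12, x13, x23` collinear.
  have hU0 : U ≠ 0 := by
    intro h0
    apply hcol
    have : ((-s : ℝ) : ℂ) * (x12 + u23⁻¹ - (x12 + u13⁻¹)) = ((1 : ℝ) : ℂ) * (x12 + u23⁻¹ - x12) := by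
      push_cast
      field_simp
      rw [e13, e23, h0]
      ring
    exact mul_conj_sub_eq_zero (.inr one_ne_zero) this
  refine ⟨x12 + U⁻¹, ?_, ?_, ?_, ?_⟩
  · have : ((-s : ℝ) : ℂ) * ((x12 + U⁻¹ - x12) * (x12 + u23⁻¹ - (x12 + u13⁻¹))) =
        ((1 : ℝ) : ℂ) * ((x12 + U⁻¹ - (x12 + u13⁻¹)) * (x12 + u23⁻¹ - x12)) := by
      push_cast
      field_simp
      rw [e13, e23]
      ring
    exact mul_conj_sub_eq_zero (.inr one_ne_zero) this
  -- The real cross-ratio is `(s + 1) : (t + 1)`; both terms vanish only if `u23 = u24 = U`.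
  · have h0 : t + 1 ≠ 0 ∨ s + 1 ≠ 0 := by
      by_contra! h
      apply e2324
      rw [e23, e24]
      have h1 : (t : ℂ) + 1 = 0 := by exact_mod_cast h.1
      have h2 : (s : ℂ) + 1 = 0 := by exact_mod_cast h.2
      rw [h1, h2]
      ring
    have : ((t + 1 : ℝ) : ℂ) *
        ((x12 + U⁻¹ - (x12 + u23⁻¹)) * (x12 + u34⁻¹ - (x12 + u24⁻¹))) =
        ((s + 1 : ℝ) : ℂ) * ((x12 + U⁻¹ - (x12 + u24⁻¹)) * (x12 + u34⁻¹ - (x12 + u23⁻¹))) := by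
      push_cast
      field_simp
      rw [e13, e14] at hI
      rw [e23, e24]
      linear_combination (t + 1) * (s + 1) * hI
    exact mul_conj_sub_eq_zero h0 this
  · have h0 : t ≠ 0 ∨ s ≠ 0 := by
      by_contra! h
      apply e1314
      rw [e13, e14, h.1, h.2]
      simp
    have : (t : ℂ) *
        ((x12 + U⁻¹ - (x12 + u13⁻¹)) * (x12 + u34⁻¹ - (x12 + u14⁻¹))) =
        (s : ℂ) * ((x12 + U⁻¹ - (x12 + u14⁻¹)) * (x12 + u34⁻¹ - (x12 + u13⁻¹))) := by
      field_simp
      rw [e13, e14] at hI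
      rw [e13, e14]
      linear_combination t * s * hI
    exact mul_conj_sub_eq_zero h0 this
  · have : ((-t : ℝ) : ℂ) * ((x12 + U⁻¹ - x12) * (x12 + u24⁻¹ - (x12 + u14⁻¹))) =
        ((1 : ℝ) : ℂ) * ((x12 + U⁻¹ - (x12 + u14⁻¹)) * (x12 + u24⁻¹ - x12)) := by
      push_cast
      field_simp
      rw [e14, e24]
      ring
    exact mul_conj_sub_eq_zero (.inr one_ne_zero) this

end Concyclic

/-! ### From the multi-ratio equation to a `C₄` pattern. -/

section Octahedron

/-- The faces of the octahedron with vertices `x12, x13, x14, x23, x24, x34` numbered from `0` to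
`5`; the first four faces are pairwise nonadjacent. -/
def octFace : Fin 8 → Fin 3 → Fin 6 :=
  ![![0, 3, 1], ![3, 5, 4], ![1, 5, 2], ![0, 4, 2], ![1, 0, 2], ![3, 0, 4], ![5, 3, 1], ![5, 4, 2]]

/-- No face is collinear, and no other vertex is on the circle through a face. -/
def OctNondeg (x : Fin 6 → ℂ) : Prop :=
  (∀ f, collinearPoly (x (octFace f 0)) (x (octFace f 1)) (x (octFace f 2)) ≠ 0) ∧
  ∀ f q, (∀ l, octFace f l ≠ q) →
    concyclicPoly (x q) (x (octFace f 0)) (x (octFace f 1)) (x (octFace f 2)) ≠ 0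

theorem octFace_injective : ∀ f g : Fin 8,
    (∀ q, (∃ l, octFace f l = q) ↔ ∃ l, octFace g l = q) → f = g := by decide

theorem exists_octFace_separating : ∀ q q' : Fin 6, q ≠ q' →
    ∃ f : Fin 8, (∃ l, octFace f l = q) ∧ ∀ l, octFace f l ≠ q' := by decide

theorem exists_octFace_not_mem : ∀ q : Fin 6,
    (∃ f : Fin 4, ∀ l, octFace (Fin.castLE (by norm_num) f) l ≠ q) ∧
    (∃ f : Fin 4, ∀ l, octFace (Fin.natAdd 4 f) l ≠ q) := by decide

theorem concyclicPoly_octFace (x : Fin 6 → ℂ) (f : Fin 8) (l : Fin 3) :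
    concyclicPoly (x (octFace f l)) (x (octFace f 0)) (x (octFace f 1)) (x (octFace f 2)) = 0 := by
  fin_cases l <;> (simp [concyclicPoly]; try ring)

theorem OctNondeg.injective {x : Fin 6 → ℂ} (h : OctNondeg x) : Function.Injective x := by
  intro q q' hqq
  by_contra hne
  obtain ⟨f, ⟨l, hl⟩, hf⟩ := exists_octFace_separating q q' hne
  apply h.2 f q' hf
  rw [← hqq, ← hl]
  exact concyclicPoly_octFace x f l

theorem OctNondeg.isC4 {x : Fin 6 → ℂ} (h : OctNondeg x)
    (hq : quadPoly (x 0) (x 1) (x 2) (x 3) (x 4) (x 5) = 0) :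
    IsC4 (x 0) (x 1) (x 2) (x 3) (x 4) (x 5) := by
  have hinj := h.injective
  have hne {a b : Fin 6} (hab : a ≠ b) : x a ≠ x b := hinj.ne hab
  obtain ⟨P, hP0, hP1, hP2, hP3⟩ := exists_concurrence hq (hne (by decide)) (hne (by decide))
    (hne (by decide)) (hne (by decide)) (hne (by decide)) (hne (by decide)) (hne (by decide))
    (hne (by decide)) (h.1 0) (h.2 2 0 (by decide))
  -- Exchanging the opposite points `x12` and `x34` preserves the equation and interchanges the two
  -- families of faces, so the same lemma yields `Q`.
  have hq' : quadPoly (x 5) (x 1) (x 2) (x 3) (x 4) (x 0) = 0 := by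
    unfold quadPoly at hq ⊢
    linear_combination hq
  obtain ⟨Q, hQ2, hQ1, hQ0, hQ3⟩ := exists_concurrence hq' (hne (by decide)) (hne (by decide))
    (hne (by decide)) (hne (by decide)) (hne (by decide)) (hne (by decide)) (hne (by decide))
    (hne (by decide)) (h.1 6) (h.2 4 5 (by decide))
  choose o r hr hmem using fun f => exists_sphere (h.1 f)
  have hvert (f q) : x q ∈ Metric.sphere (o f) (r f) ↔ ∃ l, octFace f l = q := by
    rw [hmem]
    constructor
    · intro h0
      by_contra! h1
      exact h.2 f q h1 h0
    · rintro ⟨l, rfl⟩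
      exact concyclicPoly_octFace x f l
  have hP (f : Fin 4) : P ∈ Metric.sphere (o (Fin.castLE (by norm_num) f))
      (r (Fin.castLE (by norm_num) f)) := by
    rw [hmem]
    fin_cases f
    exacts [hP0, hP1, hP2, hP3]
  have hQ (f : Fin 4) : Q ∈ Metric.sphere (o (Fin.natAdd 4 f)) (r (Fin.natAdd 4 f)) := by
    rw [hmem]
    fin_cases f
    exacts [hQ0, hQ1, hQ2, hQ3]
  have hPx (q : Fin 6) : x q ≠ P := by
    rintro rfl
    obtain ⟨f, hf⟩ := (exists_octFace_not_mem q).1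
    obtain ⟨l, hl⟩ := (hvert _ q).1 (hP f)
    exact hf l hl
  have hQx (q : Fin 6) : x q ≠ Q := by
    rintro rfl
    obtain ⟨f, hf⟩ := (exists_octFace_not_mem q).2
    obtain ⟨l, hl⟩ := (hvert _ q).1 (hQ f)
    exact hf l hl
  let S (f : Fin 8) : Set (OnePoint ℂ) := (fun w : ℂ => (w : OnePoint ℂ)) '' Metric.sphere (o f) (r f)
  have hS (f : Fin 8) (z : ℂ) : (z : OnePoint ℂ) ∈ S f ↔ z ∈ Metric.sphere (o f) (r f) := by
    simp [S]
  have hSinj : Function.Injective S := by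
    intro f g hfg
    refine octFace_injective f g fun q => ?_
    rw [← hvert, ← hvert, ← hS, ← hS, hfg]
  -- The faces `0` and `4` share `x12` and `x13`. Their distinct circles have no third common point,
  -- and neither `P` nor `Q` is a vertex.
  have hPQ : P ≠ Q := by
    rintro rfl
    have hne0 : (⟨o 0, r 0⟩ : EuclideanGeometry.Sphere ℂ) ≠ ⟨o 4, r 4⟩ := by
      intro h0
      have h1 := congrArg EuclideanGeometry.Sphere.center h0
      have h2 := congrArg EuclideanGeometry.Sphere.radius h0
      simp only at h1 h2
      have : S 0 = S 4 := by simp only [S, h1, h2]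
      exact absurd (hSinj this) (by decide)
    rcases EuclideanGeometry.eq_of_mem_sphere_of_mem_sphere_of_finrank_eq_two
      Complex.finrank_real_complex hne0 (hne (show (0 : Fin 6) ≠ 1 by decide)) (p := P)
      ((hvert 0 0).2 (by decide)) ((hvert 0 1).2 (by decide)) (hP 0)
      ((hvert 4 0).2 (by decide)) ((hvert 4 1).2 (by decide)) (hQ 0) with h0 | h0
    · exact hPx 0 h0.symm
    · exact hPx 1 h0.symm
  have hcirc (f) : IsCircle (S f) := .inl ⟨o f, r f, hr f, rfl⟩
  have hv (f : Fin 8) (q : Fin 6) (hfq : ∃ l, octFace f l = q) : (x q : OnePoint ℂ) ∈ S f :=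
    (hS f _).2 ((hvert f q).2 hfq)
  refine ⟨P, Q, fun a => S (Fin.castLE (by norm_num) a), fun a => S (Fin.natAdd 4 a), ?_, ?_,
    fun a => hcirc _, fun a => hcirc _, ?_, ?_, ?_, ?_, fun a => (hS _ _).2 (hP a),
    ?_, ?_, ?_, ?_, fun a => (hS _ _).2 (hQ a)⟩
  · simp only [List.nodup_cons, List.mem_cons, List.not_mem_nil, or_false, not_or,
      OnePoint.coe_eq_coe, hinj.eq_iff, hPx, hQx, hPQ]
    simp
  · rintro (a | a) (b | b) hab <;> have := hSinj hab <;> simp [Fin.ext_iff] at this ⊢ <;> omega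
  all_goals
    simp only [Set.insert_subset_iff, Set.singleton_subset_iff]
    exact ⟨hv _ _ (by decide), hv _ _ (by decide), hv _ _ (by decide)⟩

end Octahedron

/-! ### Generic octahedra are nondegenerate. -/

section GenericOctahedron

theorem RatOn.collinearPoly {ι : Type*} {R : Set (ι → ℂ)} {a b c : (ι → ℂ) → ℂ}
    (ha : RatOn R a) (hb : RatOn R b) (hc : RatOn R c) :
    RatOn R (fun y => collinearPoly (a y) (b y) (c y)) :=
  ((hb.sub hc).mul (hb.sub ha).conj).sub ((hb.sub hc).conj.mul (hb.sub ha))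

theorem RatOn.concyclicPoly {ι : Type*} {R : Set (ι → ℂ)} {z a b c : (ι → ℂ) → ℂ}
    (hz : RatOn R z) (ha : RatOn R a) (hb : RatOn R b) (hc : RatOn R c) :
    RatOn R (fun y => concyclicPoly (z y) (a y) (b y) (c y)) :=
  (((hz.sub ha).mul (hb.sub hc)).mul ((hz.sub hc).mul (hb.sub ha)).conj).sub
    (((hz.sub ha).mul (hb.sub hc)).conj.mul ((hz.sub hc).mul (hb.sub ha)))

/-- The example is symmetric under `z ↦ -z`, which exchanges opposite vertices; any such octahedron
satisfies the multi-ratio equation. -/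
theorem octNondeg_model :
    OctNondeg ![1, 2 * Complex.I, 3 + Complex.I, -(3 + Complex.I), -(2 * Complex.I), -1] := by
  constructor
  · intro f h
    replace h := congrArg Complex.im h
    fin_cases f <;> simp [octFace, collinearPoly] at h <;> norm_num at h
  · intro f q hq h
    replace h := congrArg Complex.im h
    fin_cases f <;> fin_cases q <;> first
      | exact hq 0 rfl
      | exact hq 1 rfl
      | exact hq 2 rfl
      | (simp [octFace, concyclicPoly] at h; norm_num at h)

variable {k i j : ℕ}

/-- The vertices of the octahedral cell of an array. -/
noncomputable def octPoints (y : Pos k i j → ℂ) : Fin 6 → ℂ :=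
  ![y (.inl 0), y (.inr (0, 1)), y (.inr (0, 0)), y (.inr (1, 1)), y (.inr (1, 0)),
    sixth (y (.inl 0)) (y (.inr (0, 1))) (y (.inr (0, 0))) (y (.inr (1, 1))) (y (.inr (1, 0)))]

/-- The numeral `1` in `Fin 1` is `0`; this is where `i, j ≥ 1` matters, so that position `(1, 1)`
is off the first row and column. -/
theorem one_ne_zero_fin {n : ℕ} (hn : 1 ≤ n) : (1 : Fin (n + 1)) ≠ 0 := by
  obtain ⟨n, rfl⟩ := Nat.exists_eq_add_of_le' hn
  exact one_ne_zero

theorem big_octNondeg (hi : 1 ≤ i) (hj : 1 ≤ j) :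
    Big {y : Pos k i j → ℂ | OctNondeg (octPoints y)} := by
  have hi1 := one_ne_zero_fin hi
  have hj1 := one_ne_zero_fin hj
  let R : Set (Pos k i j → ℂ) := {y | sixthDen (y (.inl 0)) (y (.inr (0, 1))) (y (.inr (0, 0)))
    (y (.inr (1, 1))) (y (.inr (1, 0))) ≠ 0}
  let y0 : Pos k i j → ℂ
    | .inl _ => 1
    | .inr (m, n) => if m = 0 then (if n = 0 then 3 + Complex.I else 2 * Complex.I) else
      (if n = 0 then -(2 * Complex.I) else -(3 + Complex.I))
  have hy0 : y0 ∈ R := by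
    intro h
    replace h := congrArg Complex.re h
    simp [y0, hi1, hj1, sixthDen] at h
    norm_num at h
  have hpts : octPoints y0 =
      ![1, 2 * Complex.I, 3 + Complex.I, -(3 + Complex.I), -(2 * Complex.I), -1] := by
    have : -1 = sixth (y0 (.inl 0)) (y0 (.inr (0, 1))) (y0 (.inr (0, 0)))
        (y0 (.inr (1, 1))) (y0 (.inr (1, 0))) := by
      rw [eq_sixth_iff hy0]
      simp [y0, hi1, hj1, quadPoly]
      ring
    rw [octPoints, ← this]
    simp [y0, hi1, hj1]
  have hR : Big R := ((ratOn_apply _).sixthDen (ratOn_apply _) (ratOn_apply _) (ratOn_apply _)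
    (ratOn_apply _)).big_ne_zero_of_univ hy0
  have hrat (q : Fin 6) : RatOn R (fun y => octPoints y q) := by
    fin_cases q
    · exact ratOn_apply _
    · exact ratOn_apply _
    · exact ratOn_apply _
    · exact ratOn_apply _
    · exact ratOn_apply _
    · exact (ratOn_apply _).sixth (ratOn_apply _) (ratOn_apply _) (ratOn_apply _)
        (ratOn_apply _) fun y hy => hy
  have h0 := octNondeg_model
  rw [← hpts] at h0
  refine ((Big.iInter fun f : Fin 8 => ((hrat _).collinearPoly (hrat _) (hrat _)).big_ne_zero hR hy0
    (h0.1 f)).inter (Big.iInter fun f : Fin 8 => Big.iInter fun q : Fin 6 => ?_ :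
      Big {y | ∀ f q, y ∈ {y : Pos k i j → ℂ | (∀ l, octFace f l ≠ q) →
        concyclicPoly (octPoints y q) (octPoints y (octFace f 0)) (octPoints y (octFace f 1))
          (octPoints y (octFace f 2)) ≠ 0}})).mono ?_
  · by_cases hq : ∀ l, octFace f l ≠ q
    · exact (((hrat _).concyclicPoly (hrat _) (hrat _) (hrat _)).big_ne_zero hR hy0
        (h0.2 f q hq)).mono fun y hy _ => hy.2
    · exact big_univ.mono fun y _ h => absurd h hq
  · rintro y ⟨h1, h2⟩
    exact ⟨fun f => (h1 f).2, h2⟩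

end GenericOctahedron

/-! ### Vertices as the orbit of the last variable. -/

section Vertices
variable {k i j : ℕ}

/-- The element of the Coxeter group taking the base vertex to `detVertex p`. -/
noncomputable def detWord : Pos k i j → W k i j
  | .inl n => rProd k i j (n.val + 1)
  | .inr (m, n) => tProd k i j m.val * sProd k i j n.val * rProd k i j 0

theorem detVertex_eq (p : Pos k i j) : detVertex p = ((detWord p : W k i j) : Vertex k i j) := by
  have h (g : W k i j) : g • baseVertex k i j = (g : Vertex k i j) :=
    congrArg (QuotientGroup.mk (s := vertexStabilizer k i j)) (mul_one g)
  rcases p with n | ⟨m, n⟩ <;> exact h _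

theorem rProd_eq_mul (n : Fin (k + 1)) :
    rProd k i j n.val = gen (.inl n) * rProd k i j (n.val + 1) := by
  rw [rProd, List.drop_eq_getElem_cons (by simp; omega), List.prod_cons, List.getElem_ofFn]
  rfl

theorem rProd_last : rProd k i j (k + 1) = 1 := by
  rw [rProd, List.drop_eq_nil_of_le (by simp), List.prod_nil]

theorem tProd_succ (m : Fin i) : tProd k i j (m.val + 1) = gen (.inr (.inl m)) * tProd k i j m.val := by
  rw [tProd, List.take_succ_eq_append_getElem (by simp), List.reverse_append, List.prod_append]
  simp [tProd]

theorem sProd_succ (n : Fin j) : sProd k i j (n.val + 1) = gen (.inr (.inr n)) * sProd k i j n.val := by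
  rw [sProd, List.take_succ_eq_append_getElem (by simp), List.reverse_append, List.prod_append]
  simp [sProd]

theorem birationalAction_rProd (n : Fin (k + 1)) :
    birationalAction k i j (rProd k i j (n.val + 1)) (var (.inl (Fin.last k))) = var (.inl n) := by
  induction n using Fin.reverseInduction with
  | last => simp [rProd_last]
  | cast n ih =>
    have := rProd_eq_mul (i := i) (j := j) n.succ
    rw [Fin.val_succ] at this ih
    rw [Fin.val_castSucc, this, map_mul, AlgEquiv.mul_apply, ih, birationalAction_gen_var,
      act_apply (by simp)]
    congr 1
    exact congrArg Sum.inl (Equiv.swap_apply_right _ _)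

theorem birationalAction_detWord (p : Pos k i j) :
    birationalAction k i j (detWord p) (var (.inl (Fin.last k))) = var p := by
  rcases p with n | ⟨m, n⟩
  · exact birationalAction_rProd n
  have h0 : birationalAction k i j (rProd k i j 0) (var (.inl (Fin.last k))) = var (.inr (0, 0)) := by
    have := rProd_eq_mul (i := i) (j := j) (0 : Fin (k + 1))
    have h1 := birationalAction_rProd (i := i) (j := j) (0 : Fin (k + 1))
    rw [Fin.val_zero] at this h1
    rw [this, map_mul, AlgEquiv.mul_apply, h1, birationalAction_gen_var, act_zero, actR0_inl_zero]
  have h1 (n : Fin (j + 1)) : birationalAction k i j (sProd k i j n.val) (var (.inr (0, 0))) =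
      var (.inr (0, n)) := by
    induction n using Fin.induction with
    | zero => simp [sProd]
    | succ n ih =>
      rw [Fin.val_succ, sProd_succ, map_mul, AlgEquiv.mul_apply]
      rw [Fin.val_castSucc] at ih
      rw [ih, birationalAction_gen_var, act_apply (by simp)]
      congr 1
      exact congrArg (fun x => Sum.inr (0, x)) (Equiv.swap_apply_left _ _)
  have h2 (m : Fin (i + 1)) : birationalAction k i j (tProd k i j m.val) (var (.inr (0, n))) =
      var (.inr (m, n)) := by
    induction m using Fin.induction with
    | zero => simp [tProd]
    | succ m ih =>
      rw [Fin.val_succ, tProd_succ, map_mul, AlgEquiv.mul_apply]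
      rw [Fin.val_castSucc] at ih
      rw [ih, birationalAction_gen_var, act_apply (by simp)]
      congr 1
      exact congrArg (fun x => Sum.inr (x, n)) (Equiv.swap_apply_left _ _)
  rw [detWord, map_mul, map_mul, AlgEquiv.mul_apply, AlgEquiv.mul_apply, h0, h1, h2]

/-- Orbit and stabiliser: the stabiliser of `y_k` is the subgroup defining the cosets. This makes
the figure well defined and, generically, injective. -/
theorem mk_eq_mk_iff (w w' : W k i j) : (w : Vertex k i j) = (w' : Vertex k i j) ↔
    birationalAction k i j w (var (.inl (Fin.last k))) =
      birationalAction k i j w' (var (.inl (Fin.last k))) := by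
  have e : birationalAction k i j w' (var (.inl (Fin.last k))) =
      birationalAction k i j w (birationalAction k i j (w⁻¹ * w') (var (.inl (Fin.last k)))) := by
    rw [← AlgEquiv.mul_apply, ← map_mul, mul_inv_cancel_left]
  rw [QuotientGroup.eq, e, (birationalAction k i j w).injective.eq_iff]
  exact ⟨fun h => (fixes_of_mem_vertexStabilizer h).symm,
    fun h => mem_vertexStabilizer_of_fixes h.symm⟩

theorem smul_mk (w w' : W k i j) : w • (w' : Vertex k i j) = ((w * w' : W k i j) : Vertex k i j) :=
  rfl

/-- Relations between vertices of the determining set follow from those between variables, with no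
computation in the Coxeter group. -/
theorem gen_smul_detVertex {a : Node k i j} {p p' : Pos k i j}
    (h : act a (var : Pos k i j → RatField k i j) p = var p') :
    (gen a : W k i j) • detVertex p = detVertex p' := by
  rw [detVertex_eq, detVertex_eq, smul_mk, mk_eq_mk_iff, map_mul, AlgEquiv.mul_apply,
    birationalAction_detWord, birationalAction_detWord, birationalAction_gen_var, h]

theorem detVertex_last : detVertex (.inl (Fin.last k)) = baseVertex k i j := by
  rw [detVertex_eq, detWord, Fin.val_last, rProd_last]
  rfl

instance : Countable (W k i j) := by
  have := (coxeterMatrix k i j).toCoxeterSystem.wordProd_surjective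
  exact this.countable

end Vertices

/-! ### Existence and uniqueness of the figure. -/

section GeneralPosition
variable {k i j : ℕ}

/-- Removing the last letter of `w` replaces `U` by its preimage under a generator, so the induction
has to run over all `U`. -/
theorem Big.preimage_birationalAction {U : Set (Pos k i j → ℂ)} (hU : Big U) (w : W k i j) :
    Big {y | ∃ z ∈ U, ArrayValue (fun p => birationalAction k i j w (var p)) y z} := by
  induction w using gen_induction generalizing U with
  | one => exact hU.mono fun y hy => ⟨y, hy, by simpa using arrayValue_var y⟩
  | mul_gen w a ih =>
    refine (ih (hU.preimage_act a)).mono ?_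
    rintro y ⟨z, ⟨hz, hz'⟩, h⟩
    rw [Set.mem_ofPred_eq, birationalAction_mul_gen_var]
    exact ⟨_, hz', h.act hz⟩

theorem succ_zero_eq_one {n : ℕ} (hn : 0 < n) : (⟨0, hn⟩ : Fin n).succ = 1 := by
  obtain ⟨n, rfl⟩ := Nat.exists_eq_add_of_le' hn
  rfl

theorem big_values_ne {f g : RatField k i j} (h : f ≠ g) :
    Big {y : Pos k i j → ℂ | ∀ z, HasValueAt f y z → ¬ HasValueAt g y z} := by
  obtain ⟨p, q, hq, hpq⟩ := IsFractionRing.div_surjective (A := MvPolynomial (Pos k i j) ℂ) (f - g)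
  have hp : p ≠ 0 := by
    rintro rfl
    rw [map_zero, zero_div] at hpq
    exact h (sub_eq_zero.1 hpq.symm)
  refine ((big_eval_ne_zero hp).inter (big_eval_ne_zero (nonZeroDivisors.ne_zero hq))).mono ?_
  rintro y ⟨hp', hq'⟩ z hf hg
  have h1 := hf.sub hg
  have h2 : HasValueAt (f - g) y (MvPolynomial.eval y p / MvPolynomial.eval y q) :=
    ⟨p, q, hq', hpq.symm, rfl⟩
  have h3 := h1.unique h2
  rw [sub_self] at h3
  exact div_ne_zero hp' hq' h3.symm

variable {A : W k i j → Pos k i j → ℂ} {y : Pos k i j → ℂ}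

theorem arrayValue_mul_gen
    (hA : ∀ w, ArrayValue (fun p => birationalAction k i j w (var p)) y (A w))
    (hR : ∀ w, Reg (A w)) (w : W k i j) (a : Node k i j) : A (w * gen a) = act a (A w) := by
  funext p
  have h := (hA w).act (a := a) fun _ => hR w
  rw [← birationalAction_mul_gen_var] at h
  exact (hA (w * gen a) p).unique (h p)

/-- The map of the vertices given by the values of the birational action. -/
noncomputable def figure
    (hA : ∀ w, ArrayValue (fun p => birationalAction k i j w (var p)) y (A w)) :
    Vertex k i j → OnePoint ℂ :=
  fun v => Quotient.liftOn' v (fun w => (A w (.inl (Fin.last k)) : OnePoint ℂ)) fun w w' h => by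
    have h1 := (mk_eq_mk_iff w w').1 (Quotient.sound' h)
    have h2 := hA w (.inl (Fin.last k))
    simp only [h1] at h2
    rw [h2.unique (hA w' (.inl (Fin.last k)))]

theorem figure_mk (hA : ∀ w, ArrayValue (fun p => birationalAction k i j w (var p)) y (A w))
    (w : W k i j) : figure hA (w : Vertex k i j) = (A w (.inl (Fin.last k)) : OnePoint ℂ) := rfl

theorem figure_smul_detVertex
    (hA : ∀ w, ArrayValue (fun p => birationalAction k i j w (var p)) y (A w))
    (w : W k i j) (p : Pos k i j) : figure hA (w • detVertex p) = (A w p : OnePoint ℂ) := by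
  rw [detVertex_eq, smul_mk, figure_mk]
  have h := hA (w * detWord p) (.inl (Fin.last k))
  simp only [map_mul, AlgEquiv.mul_apply, birationalAction_detWord] at h
  rw [h.unique (hA w p)]

theorem c4Constraint_figure (hi : 1 ≤ i) (hj : 1 ≤ j)
    (hA : ∀ w, ArrayValue (fun p => birationalAction k i j w (var p)) y (A w))
    (hR : ∀ w, Reg (A w)) (hO : ∀ w, OctNondeg (octPoints (A w))) :
    C4Constraint (figure hA) := by
  have hi1 := one_ne_zero_fin hi
  have hj1 := one_ne_zero_fin hj
  intro w
  rw [← mul_smul]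
  simp only [figure_smul_detVertex, arrayValue_mul_gen hA hR, act_zero, actR0_inr _ hi1 hj1]
  exact (hO w).isC4 (quadPoly_sixth (hR w 1 1 hi1 hj1).2)

theorem c4Constraint_unique (hi : 1 ≤ i) (hj : 1 ≤ j)
    (hA : ∀ w, ArrayValue (fun p => birationalAction k i j w (var p)) y (A w))
    (hR : ∀ w, Reg (A w)) {x : Vertex k i j → OnePoint ℂ} (hx : C4Constraint x)
    (hxy : ∀ p, x (detVertex p) = (y p : OnePoint ℂ)) : x = figure hA := by
  have hi1 := one_ne_zero_fin hi
  have hj1 := one_ne_zero_fin hj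
  have hmul := arrayValue_mul_gen hA hR
  have hperm {w : W k i j} (hw : ∀ p, x (w • detVertex p) = (A w p : OnePoint ℂ))
      {b : Node k i j} (hb : b ≠ .inl 0) (p : Pos k i j) :
      x ((w * gen b) • detVertex p) = (A (w * gen b) p : OnePoint ℂ) := by
    rw [mul_smul, gen_smul_detVertex (act_apply hb var p), hw, hmul, act_apply hb]
  -- Agreement with the figure passes from `w` to `w r_0` at position `p`. Quantifying over `w`
  -- allows `w` to be replaced by `w b` below.
  let L (p : Pos k i j) : Prop := ∀ w : W k i j,
    (∀ p, x (w • detVertex p) = (A w p : OnePoint ℂ)) →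
      x ((w * gen (.inl 0)) • detVertex p) = (A (w * gen (.inl 0)) p : OnePoint ℂ)
  have hL1 : L (.inr (1, 1)) := by
    intro w hw
    have := hx w
    rw [← mul_smul] at this
    simp only [hw] at this
    rw [this.eq_sixth (hR w 1 1 hi1 hj1).2, hmul, act_zero, actR0_inr _ hi1 hj1]
  -- Since `b` commutes with `r_0`, the vertex `w r_0 d(p')` is `(w b) r_0 d(p)`. The later `t_m`
  -- and `s_n` thus spread the octahedral condition from `(1, 1)`.
  have hLstep {b : Node k i j} (hb : b ≠ .inl 0) (h : ¬ Link (.inl 0) b) (h' : ¬ Link b (.inl 0))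
      {p p' : Pos k i j} (hpp : nodePerm b p = p') (hp : L p) : L p' := by
    intro w hw
    have e : act b (var : Pos k i j → RatField k i j) p = var p' := by rw [act_apply hb, hpp]
    have := hp (w * gen b) (hperm hw hb)
    rw [mul_assoc, gen_commute hb h' h, ← mul_assoc] at this
    rw [← gen_smul_detVertex e, ← mul_smul, this, hmul, act_apply hb, hpp]
  have hLcol (n : Fin (j + 1)) (hn : n ≠ 0) : L (.inr (1, n)) := by
    obtain ⟨n, rfl⟩ := Fin.exists_succ_eq.2 hn
    obtain ⟨n, hnj⟩ := n
    induction n with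
    | zero =>
      rw [succ_zero_eq_one]
      exact hL1
    | succ n ih =>
      refine hLstep (b := .inr (.inr ⟨n + 1, hnj⟩)) (by simp) (by simp [Link]) (by simp [Link]) ?_
        (ih (by omega) (Fin.succ_ne_zero _))
      exact congrArg (fun x => Sum.inr (1, x)) (Equiv.swap_apply_left _ _)
  have hLall (m : Fin (i + 1)) (n : Fin (j + 1)) (hm : m ≠ 0) (hn : n ≠ 0) : L (.inr (m, n)) := by
    obtain ⟨m, rfl⟩ := Fin.exists_succ_eq.2 hm
    obtain ⟨m, hmi⟩ := m
    induction m with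
    | zero =>
      rw [succ_zero_eq_one]
      exact hLcol n hn
    | succ m ih =>
      refine hLstep (b := .inr (.inl ⟨m + 1, hmi⟩)) (by simp) (by simp [Link]) (by simp [Link]) ?_
        (ih (by omega) (Fin.succ_ne_zero _))
      exact congrArg (fun x => Sum.inr (x, n)) (Equiv.swap_apply_left _ _)
  have hall (w : W k i j) : ∀ p, x (w • detVertex p) = (A w p : OnePoint ℂ) := by
    induction w using gen_induction with
    | one =>
      intro p
      have := hA 1 p
      simp only [map_one, AlgEquiv.one_apply] at this
      rw [one_smul, hxy, (hasValueAt_var p).unique this]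
    | mul_gen w a ih =>
      by_cases ha : a = .inl 0
      · subst ha
        intro p
        -- At the positions that `r_0` merely permutes or fixes, the vertices are already known from
        -- `w`.
        have aux {p' : Pos k i j} (h : act (.inl 0) (var : Pos k i j → RatField k i j) p = var p')
            (h' : actR0 (A w) p = A w p') :
            x ((w * gen (.inl 0)) • detVertex p) = (A (w * gen (.inl 0)) p : OnePoint ℂ) := by
          rw [mul_smul, gen_smul_detVertex h, ih, hmul, act_zero, h']
        rcases p with n | ⟨m, n⟩
        · by_cases hn : n = 0
          · subst hn; exact aux (actR0_inl_zero var) (actR0_inl_zero _)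
          · exact aux (actR0_inl _ hn) (actR0_inl _ hn)
        · by_cases hm : m = 0 <;> by_cases hn : n = 0
          · subst hm hn; exact aux (actR0_zero_zero var) (actR0_zero_zero _)
          · subst hm; exact aux (actR0_zero_left _ hn) (actR0_zero_left _ hn)
          · subst hn; exact aux (actR0_zero_right _ hm) (actR0_zero_right _ hm)
          · exact hLall m n hm hn w ih
      · exact hperm ih ha
  funext v
  induction v using QuotientGroup.induction_on with
  | H w =>
    have e : (w : Vertex k i j) = w • detVertex (.inl (Fin.last k)) := by
      rw [detVertex_last]
      exact congrArg (QuotientGroup.mk (s := vertexStabilizer k i j)) (mul_one w).symm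
    rw [e, hall, figure_smul_detVertex]

end GeneralPosition
end GossetElte

/-! ### The main theorem. -/

theorem corollary6p1 (k i j : ℕ) (hi : 1 ≤ i) (hj : 1 ≤ j) :
    -- the birational actions of the generators define an action of the Coxeter group
    ∃ ρ : W k i j →* (RatField k i j ≃ₐ[ℂ] RatField k i j),
      (∀ (a : Node k i j) (p : Pos k i j), ρ (gen a) (var p) = act a var p) ∧
      -- general position: finitely or countably many proper real-algebraic subsets are avoided
      ∃ S : Set (MvPolynomial (Pos k i j ⊕ Pos k i j) ℂ),
        S.Countable ∧ (Finite (W k i j) → S.Finite) ∧ (0 : MvPolynomial _ ℂ) ∉ S ∧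
        ∀ y : Pos k i j → ℂ,
          (∀ f ∈ S, MvPolynomial.eval (Sum.elim y fun p => starRingEnd ℂ (y p)) f ≠ 0) →
          ∃ x : Vertex k i j → OnePoint ℂ,
            Function.Injective x ∧
            C4Constraint x ∧
            (∀ p, x (detVertex p) = (y p : OnePoint ℂ)) ∧
            (∀ x' : Vertex k i j → OnePoint ℂ, C4Constraint x' →
              (∀ p, x' (detVertex p) = (y p : OnePoint ℂ)) → x' = x) ∧
            ∀ (w : W k i j) (p : Pos k i j), ∃ z : ℂ,
              HasValueAt (ρ w (var p)) y z ∧ x (w • detVertex p) = (z : OnePoint ℂ) := by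
  classical
  refine ⟨birationalAction k i j, birationalAction_gen_var, ?_⟩
  have hbig (w : W k i j) := ((big_reg (k := k)).inter
    (big_octNondeg hi hj)).preimage_birationalAction w
  -- Distinct vertices give distinct rational functions, whose values differ generically. Indexing
  -- by pairs of group elements keeps the exceptional family countable, and finite with the group.
  have hsep (u : W k i j × W k i j) : Big {y : Pos k i j → ℂ |
      (u.1 : Vertex k i j) ≠ (u.2 : Vertex k i j) →
        ∀ z, HasValueAt (birationalAction k i j u.1 (var (.inl (Fin.last k)))) y z →
          ¬ HasValueAt (birationalAction k i j u.2 (var (.inl (Fin.last k)))) y z} := by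
    by_cases h : (u.1 : Vertex k i j) = (u.2 : Vertex k i j)
    · exact big_univ.mono fun y _ h' => absurd h h'
    · exact (big_values_ne fun e => h ((mk_eq_mk_iff _ _).2 e)).mono fun y hy _ => hy
  choose f hf hfy using hbig
  choose g hg hgy using hsep
  refine ⟨Set.range f ∪ Set.range g, (Set.countable_range f).union (Set.countable_range g),
    fun _ => (Set.finite_range f).union (Set.finite_range g), ?_, fun y hy => ?_⟩
  · rintro (⟨w, hw⟩ | ⟨u, hu⟩)
    exacts [hf w hw, hg u hu]
  choose A hAU hA using fun w => hfy w y (hy _ (.inl ⟨w, rfl⟩))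
  have hR (w) : Reg (A w) := (hAU w).1
  have hsmul := figure_smul_detVertex hA
  refine ⟨figure hA, ?_, c4Constraint_figure hi hj hA hR fun w => (hAU w).2, fun p => ?_,
    fun x' hx' hxy => c4Constraint_unique hi hj hA hR hx' hxy, fun w p => ⟨A w p, hA w p, hsmul w p⟩⟩
  · intro v v' hvv
    induction v using QuotientGroup.induction_on with
    | H w =>
      induction v' using QuotientGroup.induction_on with
      | H w' =>
        by_contra hne
        refine hgy (w, w') y (hy _ (.inr ⟨(w, w'), rfl⟩)) hne _ (hA w (.inl (Fin.last k))) ?_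
        rw [figure_mk, figure_mk, OnePoint.coe_eq_coe] at hvv
        rw [hvv]
        exact hA w' (.inl (Fin.last k))
  · have h := hsmul 1 p
    have h1 := hA 1 p
    simp only [map_one, AlgEquiv.one_apply] at h1
    rw [one_smul] at h
    rw [h, h1.unique (hasValueAt_var p)]
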